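/- Let $G$ be a (finite-dimensional, real) Lie group and $\pi\colon P\to X$ a smooth principal $G$-bundle (left action, locally trivial), where $X$ is a smooth manifold with an affine structure, given by affine coordinates $\varphi\colon X\to V$, an injective local diffeomorphism into a real vector space $V$ (for instance, $X$ is an affine space or an open subset of one). Let $\Delta_X(x_0,x_1)=\overrightarrow{x_0x_1}=(d_{x_0}\varphi)^{-1}(\varphi(x_1)-\varphi(x_0))\in T_{x_0}X$ be the forward difference operator of the affine structure. For $x\in X$ let $P_x=\pi^{-1}(x)$ and let $\operatorname{End}P_x$ be the set of $G$-equivariant maps $\psi\colon P_x\to P$; it is the fiber over $x$ of $\bar\pi_0\colon\operatorname{End}P=(P\times P)/G\to X$, and is a manifold for which the evaluations $\psi\mapsto\psi(p)$, $p\in P_x$, are diffeomorphisms $\operatorname{End}P_x\to P$. The target $\bar\pi_1(\psi)\in X$ is defined by $\psi(P_x)=P_{\bar\pi_1(\psi)}$. Let $\operatorname{Gau}P_x=\{\psi\in\operatorname{End}P_x:\bar\pi_1(\psi)=x\}$ be the Lie group of $G$-equivariant maps $P_x\to P_x$, with identity $\operatorname{Id}_x$. Let $\operatorname{At}P=TP/G$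 be the Atiyah vector bundle over $X$, $\overline{d\pi}\colon\operatorname{At}P\to TX$ the map induced by $d\pi$, and $\operatorname{Ad}P=\ker\overline{d\pi}$. The target trivialization $V^{\bar\pi_0}\operatorname{End}P\simeq\bar\pi_1^*\operatorname{At}P$ maps a tangent vector $v$ of $\operatorname{End}P_x=\bar\pi_0^{-1}(x)$ at $\psi$ to the class modulo $G$ of the image of $v$ in $T_{\psi(p)}P$ under the differential of the evaluation at a point $p\in P_x$ (the class does not depend on $p$). At $\psi=\operatorname{Id}_x$ it identifies $T_{\operatorname{Id}_x}\operatorname{End}P_x$ with $\operatorname{At}P_x$, and the Lie algebra $T_{\operatorname{Id}_x}\operatorname{Gau}P_x$ with $\operatorname{Ad}P_x$; let $\exp\colon\operatorname{Ad}P_x\to\operatorname{Gau}P_x$ be the Lie group exponential. Then for every $x\in X$ there is a diffeomorphism $\Delta_{\operatorname{At}}\colon\mathcal U\to\mathcal V$ from an open neighborhood $\mathcal U$ of $\operatorname{Id}_x$ in $\operatorname{End}P_x$ onto an open set $\mathcal V\subseteq\operatorname{At}P_x$ such that: 1. $\overline{d\pi}(\Delta_{\operatorname{At}}(\psi))=\Delta_X(x,\bar\pi_1(\psi))$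 for all $\psi\in\mathcal U$; 2. the restriction of $\Delta_{\operatorname{At}}$ to $\operatorname{Gau}P_x$ is the Lie group logarithm: $\Delta_{\operatorname{At}}(\operatorname{Id}_x)=0$; if $\psi\in\mathcal U\cap\operatorname{Gau}P_x$, then $\Delta_{\operatorname{At}}(\psi)\in\operatorname{Ad}P_x$ and $\exp(\Delta_{\operatorname{At}}(\psi))=\psi$; and if $a\in\mathcal V\cap\operatorname{Ad}P_x$, then $\Delta_{\operatorname{At}}^{-1}(a)=\exp(a)\in\operatorname{Gau}P_x$; 3. the differential $T_{\operatorname{Id}_x}\operatorname{End}P_x\to\operatorname{At}P_x$ of $\Delta_{\operatorname{At}}$ at $\operatorname{Id}_x$ is the target trivialization. -/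

import Mathlib

open Set
open scoped Manifold ContDiff

noncomputable section

/-- A smooth principal `G`-bundle `P → X` for a left action of `G` on `P`: the action and the
projection are smooth, and around every point of `X` there is a smooth `G`-equivariant
trivialization `π⁻¹(U) ≅ U × G` over `U`. -/
structure SmoothPrincipalBundle
    (EG EP EX : Type*)
    [NormedAddCommGroup EG] [NormedSpace ℝ EG]
    [NormedAddCommGroup EP] [NormedSpace ℝ EP]
    [NormedAddCommGroup EX] [NormedSpace ℝ EX]
    (G P X : Type*)
    [TopologicalSpace G] [ChartedSpace EG G] [Group G]
    [TopologicalSpace P] [ChartedSpace EP P]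
    [TopologicalSpace X] [ChartedSpace EX X]
    [MulAction G P] where
  /-- the bundle projection `π` -/
  proj : P → X
  contMDiff_proj : ContMDiff 𝓘(ℝ, EP) 𝓘(ℝ, EX) ∞ proj
  contMDiff_smul : ContMDiff (𝓘(ℝ, EG).prod 𝓘(ℝ, EP)) 𝓘(ℝ, EP) ∞ (fun q : G × P => q.1 • q.2)
  proj_smul : ∀ (g : G) (p : P), proj (g • p) = proj p
  exists_localTriv : ∀ x : X, ∃ (U : Set X)
    (Φ : PartialDiffeomorph 𝓘(ℝ, EP) (𝓘(ℝ, EX).prod 𝓘(ℝ, EG)) P (X × G) ∞),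
    IsOpen U ∧ x ∈ U ∧ Φ.source = proj ⁻¹' U ∧ Φ.target = U ×ˢ (univ : Set G) ∧
    (∀ p ∈ Φ.source, (Φ p).1 = proj p) ∧
    (∀ p ∈ Φ.source, ∀ g : G, (Φ (g • p)).2 = g * (Φ p).2)

namespace SmoothPrincipalBundle

section

variable {EG EP EX : Type*}
  [NormedAddCommGroup EG] [NormedSpace ℝ EG]
  [NormedAddCommGroup EP] [NormedSpace ℝ EP]
  [NormedAddCommGroup EX] [NormedSpace ℝ EX]
  {G P X : Type*}
  [TopologicalSpace G] [ChartedSpace EG G] [Group G]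
  [TopologicalSpace P] [ChartedSpace EP P]
  [TopologicalSpace X] [ChartedSpace EX X]
  [MulAction G P]
  (B : SmoothPrincipalBundle EG EP EX G P X)

/-! ### The fibers of `P` -/

/-- The fiber `P_x`. -/
abbrev Fiber (x : X) : Type _ := {p : P // B.proj p = x}

/-- The action of `G` on the fiber `P_x`. -/
def act {x : X} (g : G) (p : B.Fiber x) : B.Fiber x :=
  ⟨g • p.1, (B.proj_smul g p.1).trans p.2⟩

theorem fiber_nonempty (x : X) : Nonempty (B.Fiber x) := by
  obtain ⟨U, Φ, -, hxU, hs, ht, h1, -⟩ := B.exists_localTriv x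
  have hmem : ((x, 1) : X × G) ∈ Φ.target := by rw [ht]; exact ⟨hxU, mem_univ _⟩
  refine ⟨⟨Φ.toPartialEquiv.symm (x, 1), ?_⟩⟩
  rw [← h1 _ (Φ.toPartialEquiv.map_target hmem)]
  exact congrArg Prod.fst (Φ.toPartialEquiv.right_inv hmem)

/-- An auxiliary point of the fiber `P_x`. -/
def pt (x : X) : B.Fiber x := Classical.choice (B.fiber_nonempty x)

theorem smul_left_injective (B : SmoothPrincipalBundle EG EP EX G P X) 
    (p : P) {g h : G} (H : g • p = h • p) : g = h := by
  obtain ⟨U, Φ, -, hxU, hs, -, -, h2⟩ := B.exists_localTriv (B.proj p)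
  have hp : p ∈ Φ.source := by rw [hs]; exact hxU
  have := congrArg (fun q => (Φ q).2) H
  simp only [h2 p hp] at this
  exact mul_right_cancel this

theorem exists_smul_eq {p q : P} (H : B.proj p = B.proj q) : ∃ g : G, g • p = q := by
  obtain ⟨U, Φ, -, hxU, hs, -, h1, h2⟩ := B.exists_localTriv (B.proj p)
  have hp : p ∈ Φ.source := by rw [hs]; exact hxU
  have hq : q ∈ Φ.source := by rw [hs]; change B.proj q ∈ U; rw [← H]; exact hxU
  refine ⟨(Φ q).2 * (Φ p).2⁻¹, ?_⟩
  have hgp : ((Φ q).2 * (Φ p).2⁻¹) • p ∈ Φ.source := by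
    rw [hs]; change B.proj _ ∈ U; rw [B.proj_smul]; exact hxU
  refine Φ.toPartialEquiv.injOn hgp hq ?_
  refine Prod.ext ?_ ?_
  · exact (h1 _ hgp).trans ((B.proj_smul _ _).trans (H.trans (h1 _ hq).symm))
  · exact (h2 p hp _).trans (by simp)

/-- The group difference `p̃ p⁻¹` of two points of one fiber: the unique `g` with `g p = p̃`. -/
def diff {x : X} (p q : B.Fiber x) : G :=
  Classical.choose (B.exists_smul_eq (p.2.trans q.2.symm))

theorem diff_smul {x : X} (p q : B.Fiber x) : B.diff p q • p.1 = q.1 :=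
  Classical.choose_spec (B.exists_smul_eq (p.2.trans q.2.symm))

/-! ### The Ehresmann bundle `End P` -/

/-- The fiber `End P_x`: the `G`-equivariant maps `P_x → P`. -/
@[ext]
structure EndFiber (x : X) where
  toFun : B.Fiber x → P
  map_act : ∀ (g : G) (p : B.Fiber x), toFun (B.act g p) = g • toFun p

/-- The gauge difference `p⁻¹ q`: the unique element of `End P_x` mapping `p` to `q`. -/
def gaugeDiff {x : X} (p : B.Fiber x) (q : P) : B.EndFiber x where
  toFun r := B.diff p r • q
  map_act g r := by
    rw [← mul_smul]
    congr 1
    apply B.smul_left_injective p.1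
    rw [diff_smul, mul_smul, diff_smul]
    rfl

/-- Evaluation `ψ ↦ ψ(p)` at a point `p ∈ P_x` is a bijection `End P_x ≃ P`. -/
def evalEquiv {x : X} (p : B.Fiber x) : B.EndFiber x ≃ P where
  toFun ψ := ψ.toFun p
  invFun q := B.gaugeDiff p q
  left_inv ψ := by
    ext r
    change B.diff p r • ψ.toFun p = ψ.toFun r
    rw [← ψ.map_act]
    exact congrArg ψ.toFun (Subtype.ext (B.diff_smul p r))
  right_inv q := by
    change B.diff p p • q = q
    have : B.diff p p = 1 :=
      B.smul_left_injective p.1 ((B.diff_smul p p).trans (one_smul G p.1).symm)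
    rw [this, one_smul]

/-- The smooth structure of `End P_x = (P_x × P)/G`, the fiber over `x` of
`End P = (P × P)/G → X`, is the one for which the evaluations `End P_x ≃ P` at the points of `P_x`
are diffeomorphisms. Evaluations at two points of `P_x` differ by the action of an element of `G`,
so that the choice of the point `B.pt x` is immaterial. -/
instance instTopologicalSpaceEndFiber (x : X) : TopologicalSpace (B.EndFiber x) :=
  TopologicalSpace.induced (B.evalEquiv (B.pt x)) inferInstance

/-- Evaluation at the auxiliary point, as a homeomorphism. -/
def evalHomeomorph (x : X) : B.EndFiber x ≃ₜ P :=
  (B.evalEquiv (B.pt x)).toHomeomorphOfIsInducing ⟨rfl⟩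

instance instChartedSpaceEndFiber (x : X) : ChartedSpace EP (B.EndFiber x) where
  atlas := (fun c => (B.evalHomeomorph x).toOpenPartialHomeomorph.trans c) '' atlas EP P
  chartAt ψ := (B.evalHomeomorph x).toOpenPartialHomeomorph.trans
    (chartAt EP (B.evalHomeomorph x ψ))
  mem_chart_source ψ := by simp
  chart_mem_atlas ψ := mem_image_of_mem _ (chart_mem_atlas EP _)

instance instIsManifoldEndFiber [IsManifold 𝓘(ℝ, EP) ∞ P] (x : X) :
    IsManifold 𝓘(ℝ, EP) ∞ (B.EndFiber x) where
  compatible := by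
    rintro _ _ ⟨c, hc, rfl⟩ ⟨c', hc', rfl⟩
    have h := HasGroupoid.compatible (G := contDiffGroupoid ∞ 𝓘(ℝ, EP)) hc hc'
    refine StructureGroupoid.mem_of_eqOnSource _ h ?_
    refine ⟨?_, fun y _ => ?_⟩
    · ext y; simp
    · simp

theorem contMDiff_evalHomeomorph [IsManifold 𝓘(ℝ, EP) ∞ P] (x : X) :
    ContMDiff 𝓘(ℝ, EP) 𝓘(ℝ, EP) ∞ (B.evalHomeomorph x) := by
  intro ψ
  have h1 : ContMDiffAt 𝓘(ℝ, EP) 𝓘(ℝ, EP) ∞ (chartAt EP ψ) ψ :=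
    contMDiffOn_chart.contMDiffAt (chart_source_mem_nhds EP ψ)
  have h2 : ContMDiffAt 𝓘(ℝ, EP) 𝓘(ℝ, EP) ∞ (chartAt EP (B.evalHomeomorph x ψ)).symm
      (chartAt EP ψ ψ) :=
    contMDiffOn_chart_symm.contMDiffAt (chart_target_mem_nhds EP (B.evalHomeomorph x ψ))
  refine (h2.comp ψ h1).congr_of_eventuallyEq ?_
  filter_upwards [chart_source_mem_nhds EP ψ] with φ hφ
  have hφ' : B.evalHomeomorph x φ ∈ (chartAt EP (B.evalHomeomorph x ψ)).source := by
    exact hφ.2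
  exact ((chartAt EP (B.evalHomeomorph x ψ)).left_inv hφ').symm

theorem contMDiff_evalHomeomorph_symm [IsManifold 𝓘(ℝ, EP) ∞ P] (x : X) :
    ContMDiff 𝓘(ℝ, EP) 𝓘(ℝ, EP) ∞ (B.evalHomeomorph x).symm := by
  intro q
  obtain ⟨ψ, rfl⟩ := (B.evalHomeomorph x).surjective q
  have h1 : ContMDiffAt 𝓘(ℝ, EP) 𝓘(ℝ, EP) ∞ (chartAt EP (B.evalHomeomorph x ψ))
      (B.evalHomeomorph x ψ) :=
    contMDiffOn_chart.contMDiffAt (chart_source_mem_nhds EP _)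
  have h2 : ContMDiffAt 𝓘(ℝ, EP) 𝓘(ℝ, EP) ∞ (chartAt EP ψ).symm
      (chartAt EP (B.evalHomeomorph x ψ) (B.evalHomeomorph x ψ)) :=
    contMDiffOn_chart_symm.contMDiffAt (chart_target_mem_nhds EP ψ)
  refine (h2.comp _ h1).congr_of_eventuallyEq ?_
  filter_upwards [chart_source_mem_nhds EP (B.evalHomeomorph x ψ)] with r hr
  exact congrArg (B.evalHomeomorph x).symm
    ((chartAt EP (B.evalHomeomorph x ψ)).left_inv hr).symm

/-- The evaluation at any point `p ∈ P_x` is smooth. -/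
theorem contMDiff_eval [IsManifold 𝓘(ℝ, EP) ∞ P] {x : X} (p : B.Fiber x) :
    ContMDiff 𝓘(ℝ, EP) 𝓘(ℝ, EP) ∞ (fun ψ : B.EndFiber x => ψ.toFun p) := by
  have h : (fun ψ : B.EndFiber x => ψ.toFun p) =
      (fun q : P => B.diff (B.pt x) p • q) ∘ B.evalHomeomorph x := by
    funext ψ
    have hp : p = B.act (B.diff (B.pt x) p) (B.pt x) := Subtype.ext (B.diff_smul (B.pt x) p).symm
    conv_lhs => rw [hp]
    exact ψ.map_act _ _
  rw [h]
  exact (B.contMDiff_smul.comp (contMDiff_const.prodMk contMDiff_id)).comp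
    (B.contMDiff_evalHomeomorph x)

/-- The target `π̄₁(ψ)` of `ψ ∈ End P_x`, i.e. the point `y` with `ψ(P_x) = P_y`. -/
def target {x : X} (ψ : B.EndFiber x) : X := B.proj (ψ.toFun (B.pt x))

theorem proj_toFun {x : X} (ψ : B.EndFiber x) (p : B.Fiber x) :
    B.proj (ψ.toFun p) = B.target ψ := by
  have : p = B.act (B.diff (B.pt x) p) (B.pt x) := Subtype.ext (B.diff_smul (B.pt x) p).symm
  rw [this, ψ.map_act, B.proj_smul, target]

/-- The identity `Id_x ∈ End P_x`. -/
def idEnd (x : X) : B.EndFiber x where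
  toFun p := p.1
  map_act _ _ := rfl

/-! ### The gauge group bundle `Gau P` -/

/-- The fiber `Gau P_x`: the elements of `End P_x` whose target is `x`. -/
def Gau (x : X) : Type _ := {ψ : B.EndFiber x // B.target ψ = x}

/-- An element of `Gau P_x` as a map `P_x → P_x`. -/
def Gau.toSelf {B : SmoothPrincipalBundle EG EP EX G P X} {x : X} (ψ : B.Gau x)
    (p : B.Fiber x) : B.Fiber x :=
  ⟨ψ.1.toFun p, (B.proj_toFun ψ.1 p).trans ψ.2⟩

theorem Gau.toSelf_act {B : SmoothPrincipalBundle EG EP EX G P X} {x : X} (ψ : B.Gau x)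
    (g : G) (p : B.Fiber x) : ψ.toSelf (B.act g p) = B.act g (ψ.toSelf p) :=
  Subtype.ext (ψ.1.map_act g p)

theorem Gau.ext' {B : SmoothPrincipalBundle EG EP EX G P X} {x : X} {ψ φ : B.Gau x}
    (h : ∀ p, ψ.toSelf p = φ.toSelf p) : ψ = φ :=
  Subtype.ext (EndFiber.ext (funext fun p => congrArg Subtype.val (h p)))

/-- The group `Gau P_x`, with the groupoid multiplication `p(ψφ) = (pψ)φ`, where `pψ = ψ(p)`. -/
instance instGroupGau (x : X) : Group (B.Gau x) where
  mul ψ φ := ⟨⟨fun p => (φ.toSelf (ψ.toSelf p)).1, fun g p => by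
      rw [ψ.toSelf_act, φ.toSelf_act]; rfl⟩, (φ.toSelf (ψ.toSelf (B.pt x))).2⟩
  one := ⟨B.idEnd x, (B.pt x).2⟩
  inv ψ := ⟨B.gaugeDiff (ψ.toSelf (B.pt x)) (B.pt x).1, by
      change B.proj (_ • _) = x
      rw [B.proj_smul]
      exact (B.pt x).2⟩
  mul_assoc _ _ _ := rfl
  one_mul _ := rfl
  mul_one _ := rfl
  inv_mul_cancel ψ := by
    apply Gau.ext'
    intro p
    apply Subtype.ext
    change (ψ.toSelf (B.act (B.diff (ψ.toSelf (B.pt x)) p) (B.pt x))).1 = p.1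
    rw [ψ.toSelf_act]
    exact B.diff_smul _ p

end

section

variable {EG EP EX : Type*}
  [NormedAddCommGroup EG] [NormedSpace ℝ EG]
  [NormedAddCommGroup EP] [NormedSpace ℝ EP]
  [NormedAddCommGroup EX] [NormedSpace ℝ EX]
  {G P X : Type*}
  [TopologicalSpace G] [ChartedSpace EG G] [Group G]
  [TopologicalSpace P] [ChartedSpace EP P]
  [TopologicalSpace X] [ChartedSpace EX X]
  [MulAction G P]
  (B : SmoothPrincipalBundle EG EP EX G P X)

/-! ### The Atiyah bundle `At P = TP/G` -/

/-- The action `dλ_g` of `g ∈ G` on `TP`. -/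
def tangentAct (_B : SmoothPrincipalBundle EG EP EX G P X) (g : G) :
    TangentBundle 𝓘(ℝ, EP) P → TangentBundle 𝓘(ℝ, EP) P :=
  tangentMap 𝓘(ℝ, EP) 𝓘(ℝ, EP) (fun p : P => g • p)

theorem mdifferentiable_smul (B : SmoothPrincipalBundle EG EP EX G P X) (g : G) :
    MDifferentiable 𝓘(ℝ, EP) 𝓘(ℝ, EP) (fun p : P => g • p) :=
  (B.contMDiff_smul.comp (contMDiff_const.prodMk contMDiff_id)).mdifferentiable (by simp)

theorem tangentAct_one (a : TangentBundle 𝓘(ℝ, EP) P) : B.tangentAct 1 a = a := by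
  have : (fun p : P => (1 : G) • p) = id := funext fun p => one_smul G p
  rw [tangentAct, this, tangentMap_id]
  rfl

theorem tangentAct_mul (g h : G) (a : TangentBundle 𝓘(ℝ, EP) P) :
    B.tangentAct (g * h) a = B.tangentAct g (B.tangentAct h a) := by
  have : (fun p : P => (g * h) • p) = (fun p : P => g • p) ∘ (fun p : P => h • p) :=
    funext fun p => mul_smul g h p
  rw [tangentAct, this, tangentMap_comp (B.mdifferentiable_smul g) (B.mdifferentiable_smul h)]
  rfl

/-- The orbit relation of the action of `G` on `TP`. -/
def atSetoid : Setoid (TangentBundle 𝓘(ℝ, EP) P) where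
  r a b := ∃ g : G, B.tangentAct g a = b
  iseqv :=
    { refl := fun a => ⟨1, B.tangentAct_one a⟩
      symm := by
        rintro a _ ⟨g, rfl⟩
        exact ⟨g⁻¹, by rw [← B.tangentAct_mul, inv_mul_cancel, B.tangentAct_one]⟩
      trans := by
        rintro a _ _ ⟨g, rfl⟩ ⟨h, rfl⟩
        exact ⟨h * g, B.tangentAct_mul h g a⟩ }

/-- The Atiyah bundle `At P = TP/G`. -/
def At : Type _ := Quotient B.atSetoid

/-- The quotient map `TP → TP/G`. -/
def toAt (a : TangentBundle 𝓘(ℝ, EP) P) : B.At := Quotient.mk B.atSetoid a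

theorem tangentMap_proj_tangentAct (g : G) (a : TangentBundle 𝓘(ℝ, EP) P) :
    tangentMap 𝓘(ℝ, EP) 𝓘(ℝ, EX) B.proj (B.tangentAct g a) =
      tangentMap 𝓘(ℝ, EP) 𝓘(ℝ, EX) B.proj a := by
  have h : B.proj ∘ (fun p : P => g • p) = B.proj := funext fun p => B.proj_smul g p
  have := tangentMap_comp_at a (B.contMDiff_proj.mdifferentiable (by simp) (g • a.1))
    (B.mdifferentiable_smul g a.1)
  rw [h] at this
  exact this.symm

/-- The map `At P → TX` induced by `dπ : TP → TX`. -/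
def dproj : B.At → TangentBundle 𝓘(ℝ, EX) X :=
  Quotient.lift (tangentMap 𝓘(ℝ, EP) 𝓘(ℝ, EX) B.proj) (by
    rintro a _ ⟨g, rfl⟩
    exact (B.tangentMap_proj_tangentAct g a).symm)

/-- The fiber `At P_x` of the Atiyah bundle `At P → X`. -/
def AtFiber (x : X) : Type _ := {a : B.At // (B.dproj a).proj = x}

/-- The canonical map `T_pP → At P_x` for `p ∈ P_x`. -/
def atMk {x : X} (p : B.Fiber x) (v : TangentSpace 𝓘(ℝ, EP) p.1) : B.AtFiber x :=
  ⟨B.toAt ⟨p.1, v⟩, p.2⟩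

theorem atMk_bijective {x : X} (p : B.Fiber x) : Function.Bijective (B.atMk p) := by
  constructor
  · intro v w h
    obtain ⟨g, hg⟩ := Quotient.exact (congrArg Subtype.val h)
    have h1 : g = 1 := B.smul_left_injective p.1
      ((congrArg Bundle.TotalSpace.proj hg).trans (one_smul G p.1).symm)
    subst h1
    rw [B.tangentAct_one] at hg
    exact eq_of_heq (Bundle.TotalSpace.mk.inj hg).2
  · rintro ⟨a, ha⟩
    induction a using Quotient.inductionOn with
    | h a =>
      obtain ⟨q, w⟩ := a
      obtain ⟨g, hg⟩ := B.exists_smul_eq (p := q) (q := p.1) (ha.trans p.2.symm)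
      obtain ⟨p, hp⟩ := p
      subst hg
      exact ⟨(B.tangentAct g ⟨q, w⟩).2, Subtype.ext (Quotient.sound (B.atSetoid.symm ⟨g, rfl⟩))⟩

/-- The canonical bijection `T_pP ≃ At P_x` for `p ∈ P_x`. -/
def atEquiv {x : X} (p : B.Fiber x) : TangentSpace 𝓘(ℝ, EP) p.1 ≃ B.AtFiber x :=
  Equiv.ofBijective (B.atMk p) (B.atMk_bijective p)

/-- The vector space structure of `At P_x`, for which the bijections `T_pP ≃ At P_x`, `p ∈ P_x`,
are linear (see `atMk_linear`). -/
instance instAddCommGroupAtFiber (x : X) : AddCommGroup (B.AtFiber x) :=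
  (B.atEquiv (B.pt x)).symm.addCommGroup

instance instModuleAtFiber (x : X) : Module ℝ (B.AtFiber x) :=
  (B.atEquiv (B.pt x)).symm.module ℝ

/-- The canonical isomorphism `T_pP ≅ At P_x` at the auxiliary point `p = B.pt x`. -/
def atLinearEquiv (x : X) : TangentSpace 𝓘(ℝ, EP) (B.pt x).1 ≃ₗ[ℝ] B.AtFiber x :=
  ((B.atEquiv (B.pt x)).symm.linearEquiv ℝ).symm

theorem atMk_linear {x : X} (p : B.Fiber x) : IsLinearMap ℝ (B.atMk p) := by
  obtain ⟨g, hg⟩ := B.exists_smul_eq (p := p.1) (q := (B.pt x).1) (p.2.trans (B.pt x).2.symm)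
  have key : ∀ (q : B.Fiber x), g • p.1 = q.1 → ∃ L : TangentSpace 𝓘(ℝ, EP) p.1 →ₗ[ℝ]
      TangentSpace 𝓘(ℝ, EP) q.1, ∀ v, B.atMk p v = B.atMk q (L v) := by
    rintro ⟨q, hq⟩ h
    change g • p.1 = q at h
    subst h
    exact ⟨(mfderiv 𝓘(ℝ, EP) 𝓘(ℝ, EP) (fun p : P => g • p) p.1).toLinearMap,
      fun v => Subtype.ext (Quotient.sound ⟨g, rfl⟩)⟩
  obtain ⟨L, hL⟩ := key _ hg
  have h0 : ∀ v, B.atMk p v = B.atLinearEquiv x (L v) := hL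
  exact ⟨fun v w => by simp only [h0, map_add], fun c v => by simp only [h0, map_smul]⟩

/-- A norm on the (finite-dimensional) vector space `At P_x`. Only its equivalence class, that is
the usual topology of `At P_x`, plays a role. -/
instance instNormedAddCommGroupAtFiber (x : X) : NormedAddCommGroup (B.AtFiber x) :=
  NormedAddCommGroup.induced (B.AtFiber x) EP
    (show B.AtFiber x →ₗ[ℝ] EP from (B.atLinearEquiv x).symm.toLinearMap)
    (B.atLinearEquiv x).symm.injective

instance instNormedSpaceAtFiber (x : X) : NormedSpace ℝ (B.AtFiber x) where
  norm_smul_le c a := by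
    change ‖(show B.AtFiber x →ₗ[ℝ] EP from (B.atLinearEquiv x).symm.toLinearMap) (c • a)‖ ≤
      ‖c‖ * ‖(show B.AtFiber x →ₗ[ℝ] EP from (B.atLinearEquiv x).symm.toLinearMap) a‖
    rw [map_smul]
    exact norm_smul_le _ _

/-- The fiber `Ad P_x` of the adjoint bundle `Ad P = VP/G`, the null-space of `At P_x → T_xX`. -/
def AdFiber (x : X) : Set (B.AtFiber x) := {a | (B.dproj a.1).2 = 0}

/-! ### Target trivialization and exponential -/

/-- The target trivialization `V^{π̄₀}End P ≅ π̄₁^* At P` at `ψ ∈ End P_x`. A `π̄₀`-vertical tangent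
vector at `ψ` is a tangent vector of the fiber `End P_x`; under `T End P = (At P ⊕ At P)/Sym` it has
a unique representative of the form `(0, A)`, and it is sent to `A`. So the velocity of a curve
`p⁻¹ q(t)` in `End P_x`, with `p ∈ P_x` fixed, is sent to the class of the velocity of `q(t)`
modulo `G`. -/
def targetTriv {x : X} (ψ : B.EndFiber x) (v : TangentSpace 𝓘(ℝ, EP) ψ) : B.At :=
  B.toAt (tangentMap 𝓘(ℝ, EP) 𝓘(ℝ, EP)
    (fun φ : B.EndFiber x => φ.toFun (B.pt x)) ⟨ψ, v⟩)

/-- The target trivialization may be computed at any point `p ∈ P_x`. -/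
theorem targetTriv_eq [IsManifold 𝓘(ℝ, EP) ∞ P] {x : X} (p : B.Fiber x) (ψ : B.EndFiber x)
    (v : TangentSpace 𝓘(ℝ, EP) ψ) :
    B.targetTriv ψ v = B.toAt (tangentMap 𝓘(ℝ, EP) 𝓘(ℝ, EP)
      (fun φ : B.EndFiber x => φ.toFun p) ⟨ψ, v⟩) := by
  refine Quotient.sound ⟨B.diff (B.pt x) p, ?_⟩
  have h : (fun φ : B.EndFiber x => φ.toFun p) =
      (fun q : P => B.diff (B.pt x) p • q) ∘ fun φ : B.EndFiber x => φ.toFun (B.pt x) := by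
    funext φ
    have hp : p = B.act (B.diff (B.pt x) p) (B.pt x) := Subtype.ext (B.diff_smul (B.pt x) p).symm
    conv_lhs => rw [hp]
    exact φ.map_act _ _
  rw [h, tangentMap_comp (B.mdifferentiable_smul _)
    ((B.contMDiff_eval _).mdifferentiable (by simp))]
  rfl

/-- `ψ = exp a` for the Lie group exponential of `Gau P_x`, whose Lie algebra `T_{Id}Gau P_x` is
`Ad P_x`: there is a smooth one-parameter subgroup `γ` of `Gau P_x` with initial velocity `a` and
`γ 1 = ψ`. Here `Gau P_x` is the submanifold `π̄₁ = x` of `End P_x`. -/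
def IsExp {x : X} (a : B.AtFiber x) (ψ : B.EndFiber x) : Prop :=
  ∃ γ : ℝ → B.Gau x,
    (∀ s t, γ (s + t) = γ s * γ t) ∧
    ContMDiff 𝓘(ℝ, ℝ) 𝓘(ℝ, EP) ∞ (fun t => (γ t).1) ∧
    B.targetTriv (γ 0).1 (mfderiv 𝓘(ℝ, ℝ) 𝓘(ℝ, EP) (fun t => (γ t).1) 0 (1 : ℝ)) = a.1 ∧
    (γ 1).1 = ψ

end

end SmoothPrincipalBundle

/-- The forward difference operator `Δ_X(x₀, x₁) ∈ T_{x₀}X` of an affine structure on `X` given by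
affine coordinates `φ : X → V`: the tangent vector at `x₀` that corresponds to `φ x₁ - φ x₀`. -/
def affineDifference {EX V : Type*}
    [NormedAddCommGroup EX] [NormedSpace ℝ EX] [NormedAddCommGroup V] [NormedSpace ℝ V]
    {X : Type*} [TopologicalSpace X] [ChartedSpace EX X]
    (φ : X → V) (x₀ x₁ : X) : TangentBundle 𝓘(ℝ, EX) X :=
  ⟨x₀, ContinuousLinearMap.inverse (mfderiv 𝓘(ℝ, EX) 𝓘(ℝ, V) φ x₀) (φ x₁ - φ x₀)⟩

end

/-! Evaluation at a point p of `P_x` identifies `End P_x` with P, and T_pP with `At P_x`. So it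
suffices to find a diffeomorphism D from a neighborhood of p in P onto a neighborhood of 0 in T_pP
which has differential the identity at p, covers the affine difference of X, and is the logarithm
along the fiber (`exists_difference`). In a local trivialization q ↦ (y, g) with p ↦ (x, g_p), let
F(q) = ((dφ_x)⁻¹(φ(y) - φ(x)), log(g g_p⁻¹)) and D = (dF_p)⁻¹ ∘ F. Then dD_p = id by construction.
The first component of dF_p is dπ, because the normalized affine coordinates have differential the
identity at x; hence dπ(D(q)) is the affine difference. If q = c(1)p for a one-parameter subgroup c
with log c(1) = log(g g_p⁻¹), then F(c(t)p) = (0, log c(t)) has velocity F(q) at t = 0, so c(t)p has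
initial velocity D(q). The maps p ↦ c(t)p form the required one-parameter subgroup of `Gau P_x`
(`isExp_of_hom`).

The analytic input is a smooth local logarithm of G (`LieGroup.exists_log`). In a chart centered at
1, a left invariant field is x ↦ A(x)v with A(0) = id, and exp sends v to u(1), where u' = A(u)v and
u(0) = 0. For smoothness in v, this is read as u = ∫ A(u)v in C([0,1], E) and solved with the
inverse function theorem; a second use of that theorem inverts v ↦ u(1). Left invariance and
uniqueness for the ODE give u(s + t) = u(s)u(t), and the solution on [0,1] extends to a
one-parameter subgroup. -/

open scoped Topology

noncomputable section

/-! ### Superposition operators on spaces of continuous maps -/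

section Superposition

variable {K : Type*} [TopologicalSpace K] [CompactSpace K]
  {E F : Type*} [NormedAddCommGroup E] [NormedSpace ℝ E] [NormedAddCommGroup F] [NormedSpace ℝ F]

/-- Pointwise application of a continuous family of operators, as a bilinear map. -/
def ContinuousMap.applyCLM (K E F : Type*) [TopologicalSpace K] [CompactSpace K]
    [NormedAddCommGroup E] [NormedSpace ℝ E] [NormedAddCommGroup F] [NormedSpace ℝ F] :
    C(K, E →L[ℝ] F) →L[ℝ] C(K, E) →L[ℝ] C(K, F) :=
  LinearMap.mkContinuous₂
    (LinearMap.mk₂ ℝ (fun (T : C(K, E →L[ℝ] F)) (h : C(K, E)) =>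
        (⟨fun k => T k (h k), T.continuous.clm_apply h.continuous⟩ : C(K, F)))
      (fun _ _ _ => by ext; simp) (fun _ _ _ => by ext; simp)
      (fun _ _ _ => by ext; simp) (fun _ _ _ => by ext; simp)) 1
    (fun T h => by
      refine (ContinuousMap.norm_le _ (by positivity)).2 fun k => ?_
      rw [one_mul]
      exact ((T k).le_opNorm (h k)).trans
        (mul_le_mul (T.norm_coe_le_norm k) (h.norm_coe_le_norm k) (norm_nonneg _) (by positivity)))

/-- The mean value inequality on each segment [u k, u k + h k] bounds the remainder. The bound is
uniform in k because u ↦ f' ∘ u is continuous for the sup norm; E need not be locally compact. -/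
theorem ContinuousMap.hasFDerivAt_comp_left (f : C(E, F)) (f' : C(E, E →L[ℝ] F))
    (hf : ∀ x, HasFDerivAt f (f' x) x) (u : C(K, E)) :
    HasFDerivAt (fun u : C(K, E) => f.comp u)
      (ContinuousMap.applyCLM K E F (f'.comp u)) u := by
  rw [hasFDerivAt_iff_isLittleO_nhds_zero, Asymptotics.isLittleO_iff]
  intro ε hε
  have hc : ContinuousAt (fun u : C(K, E) => f'.comp u) u :=
    (ContinuousMap.continuous_postcomp f').continuousAt
  obtain ⟨δ, hδ, H⟩ := (Metric.continuousAt_iff (α := C(K, E)) (β := C(K, E →L[ℝ] F))).1 hc ε hε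
  filter_upwards [Metric.ball_mem_nhds (0 : C(K, E)) hδ] with h hh
  rw [mem_ball_zero_iff] at hh
  refine (ContinuousMap.norm_le _ (by positivity)).2 fun k => ?_
  have key := (convex_segment (𝕜 := ℝ) (u k) (u k + h k)).norm_image_sub_le_of_norm_hasFDerivWithin_le'
    (f := f) (f' := f') (φ := f' (u k)) (C := ε)
    (fun x _ => (hf x).hasFDerivWithinAt) ?_ (left_mem_segment ℝ _ _) (right_mem_segment ℝ _ _)
  · simp only [add_sub_cancel_left] at key
    refine key.trans ?_
    gcongr
    exact h.norm_coe_le_norm k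
  · intro x hx
    obtain ⟨s, hs, rfl⟩ := (segment_eq_image' ℝ (u k) (u k + h k)) ▸ hx
    -- The intermediate point is the value at k of `u + s • h`, which is δ-close to u in the sup
    -- norm.
    have h1 : dist (u + s • h) u < δ := by
      rw [dist_eq_norm, add_sub_cancel_left, norm_smul, Real.norm_of_nonneg hs.1]
      exact (mul_le_of_le_one_left (norm_nonneg _) hs.2).trans_lt hh
    have h2 := (ContinuousMap.dist_apply_le_dist (f := f'.comp (u + s • h)) (g := f'.comp u) k).trans
      (H h1).le
    rw [dist_eq_norm] at h2
    simpa using h2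

end Superposition

/-- The derivative is again a superposition operator, by `fderiv ℝ f`, followed by a continuous
linear map, so induction on the order applies. The induction replaces F by `E →L[ℝ] F`, whence the
common universe of E and F. -/
theorem ContinuousMap.contDiff_comp_left.{u, v} {K : Type u} [TopologicalSpace K] [CompactSpace K]
    {E F : Type v} [NormedAddCommGroup E] [NormedSpace ℝ E]
    [NormedAddCommGroup F] [NormedSpace ℝ F]
    (f : C(E, F)) (hf : ContDiff ℝ ∞ f) :
    ContDiff ℝ ∞ (fun u : C(K, E) => f.comp u) := by
  rw [contDiff_infty]
  intro n
  induction n generalizing F with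
  | zero => exact contDiff_zero.2 (ContinuousMap.continuous_postcomp f)
  | succ n ih =>
    have hf' : ContDiff ℝ ∞ (fderiv ℝ f) := hf.fderiv_right (by simp)
    refine contDiff_succ_iff_hasFDerivAt.2 ⟨_, ?_, ContinuousMap.hasFDerivAt_comp_left f
      ⟨fderiv ℝ f, hf'.continuous⟩ fun x => (hf.differentiable (by simp) x).hasFDerivAt⟩
    exact (ContinuousMap.applyCLM K E F).contDiff.comp (ih ⟨fderiv ℝ f, hf'.continuous⟩ hf')

/-! ### Integration of continuous maps -/

section Primitive

variable {E : Type*} [NormedAddCommGroup E] [NormedSpace ℝ E]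

theorem continuous_primitive_IccExtend [CompleteSpace E] (u : C(unitInterval, E)) :
    Continuous fun t : unitInterval => ∫ s in (0 : ℝ)..t, IccExtend zero_le_one u s :=
  (intervalIntegral.continuous_primitive
    (fun a b => (u.continuous.Icc_extend').intervalIntegrable a b) 0).comp continuous_subtype_val

/-- The operator `u ↦ (t ↦ ∫₀ᵗ u)` on continuous maps on the unit interval. -/
def ContinuousMap.primitiveCLM (E : Type*) [NormedAddCommGroup E] [NormedSpace ℝ E]
    [CompleteSpace E] : C(unitInterval, E) →L[ℝ] C(unitInterval, E) :=
  LinearMap.mkContinuous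
    { toFun := fun u => ⟨_, continuous_primitive_IccExtend u⟩
      map_add' := fun u v => by
        ext t
        exact intervalIntegral.integral_add ((u.continuous.Icc_extend').intervalIntegrable _ _)
          ((v.continuous.Icc_extend').intervalIntegrable _ _)
      map_smul' := fun c u => by
        ext t
        exact intervalIntegral.integral_smul c _ } 1
    (fun u => by
      refine (ContinuousMap.norm_le _ (by positivity)).2 fun t => ?_
      refine (intervalIntegral.norm_integral_le_of_norm_le_const (C := ‖u‖)
        fun s _ => u.norm_coe_le_norm _).trans ?_
      rw [sub_zero, abs_of_nonneg t.2.1, one_mul]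
      exact mul_le_of_le_one_right (norm_nonneg _) t.2.2)

end Primitive

/-! ### Inverse function theorem -/

/-- The local inverse is smooth wherever the derivative of f is invertible. Invertibility is an open
condition, so shrinking the source gives smoothness on the whole target. -/
theorem ContDiffOn.exists_openPartialHomeomorph {E F : Type*} [NormedAddCommGroup E]
    [NormedSpace ℝ E] [CompleteSpace E] [NormedAddCommGroup F] [NormedSpace ℝ F]
    {f : E → F} {U : Set E} (hU : IsOpen U) (hf : ContDiffOn ℝ ∞ f U) {a : E} (ha : a ∈ U)
    (f' : E ≃L[ℝ] F) (hf' : HasFDerivAt f (f' : E →L[ℝ] F) a) :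
    ∃ e : OpenPartialHomeomorph E F, a ∈ e.source ∧ e.source ⊆ U ∧ (e : E → F) = f ∧
      ContDiffOn ℝ ∞ e.symm e.target := by
  have hfa : ContDiffAt ℝ ∞ f a := hf.contDiffAt (hU.mem_nhds ha)
  have hcont : ContinuousOn (fderiv ℝ f) U := hf.continuousOn_fderiv_of_isOpen hU (by simp)
  have hopen : IsOpen (U ∩ fderiv ℝ f ⁻¹' range ((↑) : (E ≃L[ℝ] F) → E →L[ℝ] F)) :=
    hcont.isOpen_inter_preimage hU ContinuousLinearEquiv.isOpen
  let e₀ := hfa.toOpenPartialHomeomorph f hf' (by simp)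
  refine ⟨e₀.restrOpen _ hopen, ⟨hfa.mem_toOpenPartialHomeomorph_source hf' (by simp), ha, f', 
    hf'.fderiv.symm⟩, fun x hx => hx.2.1, rfl, fun y hy => ?_⟩
  have hx := (e₀.restrOpen _ hopen).map_target hy
  obtain ⟨g, hg⟩ := hx.2.2
  have hfx : ContDiffAt ℝ ∞ f ((e₀.restrOpen _ hopen).symm y) := hf.contDiffAt (hU.mem_nhds hx.2.1)
  refine ((e₀.restrOpen _ hopen).contDiffAt_symm hy (f₀' := g) ?_ hfx).contDiffWithinAt
  rw [hg]
  exact (hfx.differentiableAt (by simp)).hasFDerivAt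

/-! ### Extension of smooth maps -/

/-- Multiplication by a bump function suffices. Superposition operators on all of C([0,1], E) need a
globally defined map. -/
theorem ContDiffOn.exists_contDiff_eqOn {E F : Type*} [NormedAddCommGroup E]
    [NormedSpace ℝ E] [FiniteDimensional ℝ E] [NormedAddCommGroup F] [NormedSpace ℝ F]
    {f : E → F} {U : Set E} (hU : IsOpen U) (hf : ContDiffOn ℝ ∞ f U) {a : E} (ha : a ∈ U) :
    ∃ g : E → F, ContDiff ℝ ∞ g ∧ ∃ V ⊆ U, IsOpen V ∧ a ∈ V ∧ EqOn g f V := by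
  obtain ⟨r, hr, hrU⟩ := Metric.isOpen_iff.1 hU a ha
  let χ : ContDiffBump a := ⟨r / 4, r / 2, by positivity, by linarith⟩
  refine ⟨fun x => χ x • f x, ?_, Metric.ball a (r / 4), ?_, Metric.isOpen_ball,
    Metric.mem_ball_self (by positivity), ?_⟩
  · rw [contDiff_iff_contDiffAt]
    intro x
    by_cases hx : x ∈ U
    · exact χ.contDiff.contDiffAt.smul (hf.contDiffAt (hU.mem_nhds hx))
    · have hx' : x ∉ tsupport χ := by
        rw [χ.tsupport_eq]
        exact fun h => hx (hrU (Metric.closedBall_subset_ball (by change r / 2 < r; linarith) h))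
      refine (contDiffAt_const (c := (0 : F))).congr_of_eventuallyEq ?_
      filter_upwards [(isClosed_tsupport χ).isOpen_compl.mem_nhds hx'] with y hy
      rw [image_eq_zero_of_notMem_tsupport hy, zero_smul]
  · exact (Metric.ball_subset_ball (by linarith)).trans hrU
  · intro x hx
    simp only [χ.one_of_mem_closedBall (Metric.ball_subset_closedBall hx), one_smul]

/-- The shear `(v, u) ↦ (v, u - T v)` as a continuous linear equivalence. -/
def ContinuousLinearEquiv.shearSub {E F : Type*} [NormedAddCommGroup E]
    [NormedSpace ℝ E] [NormedAddCommGroup F] [NormedSpace ℝ F] (T : E →L[ℝ] F) :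
    (E × F) ≃L[ℝ] (E × F) :=
  ContinuousLinearEquiv.equivOfInverse
    ((ContinuousLinearMap.fst ℝ E F).prod
      (ContinuousLinearMap.snd ℝ E F - T ∘L ContinuousLinearMap.fst ℝ E F))
    ((ContinuousLinearMap.fst ℝ E F).prod
      (ContinuousLinearMap.snd ℝ E F + T ∘L ContinuousLinearMap.fst ℝ E F))
    (fun x => by ext <;> simp) (fun x => by ext <;> simp)

/-! ### Smooth dependence of the solutions of `x' = A(x) v` on `v` -/

/-- With N(v, u) = ∫ A(u)v, solutions are the zeros of u - N(v, u). The inverse function theorem for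
(v, u) ↦ (v, u - N(v, u)) at 0 gives a smooth family of solutions σ(v) on the full interval [0,1]
for small v; e is v ↦ σ(v)(1). -/
theorem exists_solution_openPartialHomeomorph {E : Type*} [NormedAddCommGroup E] [NormedSpace ℝ E]
    [FiniteDimensional ℝ E] {A : E → E →L[ℝ] E} {U : Set E} (hU : IsOpen U) (h0 : (0 : E) ∈ U)
    (hA : ContDiffOn ℝ ∞ A U) (hA0 : A 0 = ContinuousLinearMap.id ℝ E) :
    ∃ e : OpenPartialHomeomorph E E, 0 ∈ e.source ∧ e 0 = 0 ∧ ContDiffOn ℝ ∞ e e.source ∧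
      ContDiffOn ℝ ∞ e.symm e.target ∧ HasFDerivAt e (ContinuousLinearMap.id ℝ E) 0 ∧
      ∀ v ∈ e.source, ∃ u : ℝ → E, u 0 = 0 ∧ u 1 = e v ∧
        ∀ t ∈ Icc (0 : ℝ) 1, u t ∈ U ∧ HasDerivWithinAt u (A (u t) v) (Icc 0 1) t := by
  have : CompleteSpace E := FiniteDimensional.complete ℝ E
  obtain ⟨g, hg, V, hVU, hV, h0V, hgV⟩ := hA.exists_contDiff_eqOn hU h0
  let gC : C(E, E →L[ℝ] E) := ⟨g, hg.continuous⟩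
  let cst : E →L[ℝ] C(unitInterval, E) := ContinuousLinearMap.const ℝ unitInterval
  let ap := ContinuousMap.applyCLM unitInterval E E
  let J : C(unitInterval, E) →L[ℝ] C(unitInterval, E) := ContinuousMap.primitiveCLM E
  let N : E × C(unitInterval, E) → C(unitInterval, E) := fun q => J (ap (gC.comp q.2) (cst q.1))
  have hcomp : ContDiff ℝ ∞ (fun u : C(unitInterval, E) => gC.comp u) :=
    ContinuousMap.contDiff_comp_left gC hg
  have hap : ContDiff ℝ ∞ (fun q : E × C(unitInterval, E) => ap (gC.comp q.2)) :=
    ContDiff.comp (g := fun T => ap T) (ContinuousLinearMap.contDiff _) (hcomp.comp contDiff_snd)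
  have hN : ContDiff ℝ ∞ N :=
    J.contDiff.comp (hap.clm_apply (cst.contDiff.comp contDiff_fst))
  let T : E →L[ℝ] C(unitInterval, E) := J ∘L (ap (gC.comp 0)) ∘L cst
  -- N is linear in v, so its partial derivative in u vanishes at v = 0; only the part T in v
  -- remains.
  have hN' : HasFDerivAt N (T ∘L ContinuousLinearMap.fst ℝ E C(unitInterval, E)) 0 := by
    have h1 : HasFDerivAt (fun q : E × C(unitInterval, E) => ap (gC.comp q.2)) _ 0 :=
      (hap.differentiable (by simp) 0).hasFDerivAt
    have h2 : HasFDerivAt (fun q : E × C(unitInterval, E) => cst q.1) _ 0 :=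
      (cst ∘L ContinuousLinearMap.fst ℝ E C(unitInterval, E)).hasFDerivAt
    refine (J.hasFDerivAt.comp 0 (h1.clm_apply h2)).congr_fderiv ?_
    refine ContinuousLinearMap.ext fun q => ?_
    simp [T]
  let Ψ : E × C(unitInterval, E) → E × C(unitInterval, E) := fun q => (q.1, q.2 - N q)
  have hΨ : ContDiff ℝ ∞ Ψ := contDiff_fst.prodMk (contDiff_snd.sub hN)
  have hΨ' : HasFDerivAt Ψ (ContinuousLinearEquiv.shearSub T :
      (E × C(unitInterval, E)) →L[ℝ] (E × C(unitInterval, E))) 0 :=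
    hasFDerivAt_fst.prodMk (hasFDerivAt_snd.sub hN')
  obtain ⟨ε, hε0, -, hεΨ, hεs⟩ := hΨ.contDiffOn.exists_openPartialHomeomorph isOpen_univ
    (mem_univ _) _ hΨ'
  have hN0 : N 0 = 0 := by simp [N]
  have hΨ0 : ε 0 = 0 := by simp [hεΨ, Ψ, hN0]
  have ht0 : (0 : E × C(unitInterval, E)) ∈ ε.target := hΨ0 ▸ ε.map_source hε0
  have hs0 : ε.symm 0 = 0 := by rw [← hΨ0, ε.left_inv hε0, hΨ0]
  let ι : E →L[ℝ] E × C(unitInterval, E) := ContinuousLinearMap.inl ℝ E C(unitInterval, E)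
  let σ : E → C(unitInterval, E) := fun v => (ε.symm (ι v)).2
  let U₁ : Set E := ι ⁻¹' ε.target
  have hU₁ : IsOpen U₁ := ε.open_target.preimage ι.continuous
  have hσ : ContDiffOn ℝ ∞ σ U₁ :=
    contDiff_snd.comp_contDiffOn (hεs.comp ι.contDiff.contDiffOn (mapsTo_preimage _ _))
  -- Parameters whose solution stays in V, where the extension g agrees with A.
  let U₂ : Set E := U₁ ∩ σ ⁻¹' {u | MapsTo u univ V}
  have hU₂ : IsOpen U₂ := hσ.continuousOn.isOpen_inter_preimage hU₁
    (ContinuousMap.isOpen_setOfPred_mapsTo isCompact_univ hV)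
  have hσ0 : σ 0 = 0 := by simp only [σ, map_zero, hs0, Prod.snd_zero]
  have h0U₂ : (0 : E) ∈ U₂ := by
    refine ⟨by simpa [U₁] using ht0, ?_⟩
    change MapsTo (σ 0) univ V
    rw [hσ0]
    exact fun _ _ => h0V
  let ev : C(unitInterval, E) →L[ℝ] E := ContinuousMap.evalCLM ℝ (1 : unitInterval)
  have hX : ContDiffOn ℝ ∞ (fun v => ev (σ v)) U₂ :=
    ev.contDiff.comp_contDiffOn (hσ.mono inter_subset_left)
  have hX' : HasFDerivAt (fun v => ev (σ v)) (ContinuousLinearMap.id ℝ E) 0 := by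
    have h1 : HasFDerivAt ε.symm _ (0 : E × C(unitInterval, E)) :=
      ε.hasFDerivAt_symm ht0 (f' := ContinuousLinearEquiv.shearSub T) (by rw [hs0, hεΨ]; exact hΨ')
    have h2 : HasFDerivAt (fun v => ev (σ v)) _ 0 :=
      ev.hasFDerivAt.comp (0 : E) (hasFDerivAt_snd.comp (0 : E)
        (HasFDerivAt.comp (0 : E) (by rw [map_zero]; exact h1) ι.hasFDerivAt))
    refine h2.congr_fderiv ?_
    ext v
    -- The derivative of σ at 0 is T, and T v is t ↦ ∫₀ᵗ A(0)v = t v, with value v at 1.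
    have : (ContinuousLinearEquiv.shearSub T).symm (v, 0) = (v, 0 + T v) := rfl
    simp only [ContinuousLinearMap.comp_apply]
    change ((ContinuousLinearEquiv.shearSub T).symm (v, 0)).2 1 = v
    rw [this, zero_add]
    change ∫ s in (0 : ℝ)..(1 : unitInterval), IccExtend zero_le_one (fun _ => g 0 v) s = v
    simp [IccExtend, hgV h0V, hA0]
  obtain ⟨e, he0, hesub, heq, hes⟩ := hX.exists_openPartialHomeomorph hU₂ h0U₂
    (ContinuousLinearEquiv.refl ℝ E) hX'
  refine ⟨e, he0, by simp only [heq, hσ0, map_zero], heq ▸ hX.mono hesub, hes, heq ▸ hX', fun v hv => ?_⟩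
  have hvU := hesub hv
  have hsol : ε (ε.symm (ι v)) = ι v := ε.right_inv hvU.1
  rw [hεΨ] at hsol
  have hv1 : (ε.symm (ι v)).1 = v := congrArg Prod.fst hsol
  have hfix : σ v = J (ap (gC.comp (σ v)) (cst v)) := by
    have := congrArg Prod.snd hsol
    have h2 : σ v = N (ε.symm (ι v)) := sub_eq_zero.1 this
    simpa only [N, hv1] using h2
  let w : C(unitInterval, E) := ap (gC.comp (σ v)) (cst v)
  -- As a primitive of a continuous function on ℝ, u is differentiable also at the endpoints 0 and
  -- 1.
  let u : ℝ → E := fun t => ∫ s in (0 : ℝ)..t, IccExtend zero_le_one w s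
  have hu : ∀ t (ht : t ∈ Icc (0 : ℝ) 1), u t = σ v ⟨t, ht⟩ := fun t ht => by rw [hfix]; rfl
  refine ⟨u, by simp [u], by rw [hu 1 (by simp), heq]; rfl, fun t ht => ?_⟩
  have hutV : u t ∈ V := by rw [hu t ht]; exact hvU.2 (mem_univ _)
  refine ⟨hVU hutV, ?_⟩
  have hd : HasDerivAt u (IccExtend zero_le_one w t) t :=
    (w.continuous.Icc_extend').integral_hasStrictDerivAt 0 t |>.hasDerivAt
  rw [IccExtend_of_mem _ _ ht] at hd
  rw [← hgV hutV, hu t ht]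
  exact hd.hasDerivWithinAt

/-! ### One-parameter subgroups -/

/-- The extension is t ↦ c(fract t) c(1)^⌊t⌋. It is multiplicative because c(b) commutes with c(1):
both c(b)c(1-b) and c(1-b)c(b) equal c(1). -/
theorem exists_hom_extend_of_local {G : Type*} [Group G] {c : ℝ → G}
    (hc : ∀ s t, 0 ≤ s → 0 ≤ t → s + t ≤ 1 → c (s + t) = c s * c t) :
    ∃ C : ℝ → G, (∀ s t, C (s + t) = C s * C t) ∧ ∀ t ∈ Icc (0 : ℝ) 1, C t = c t := by
  have c0 : c 0 = 1 := by simpa using hc 0 0 le_rfl le_rfl (by norm_num)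
  have c1 : ∀ b, 0 ≤ b → b ≤ 1 → c b * c (1 - b) = c 1 := fun b h0 h1 => by
    rw [← hc b (1 - b) h0 (by linarith) (by linarith), add_sub_cancel]
  have c1' : ∀ b, 0 ≤ b → b ≤ 1 → c (1 - b) * c b = c 1 := fun b h0 h1 => by
    rw [← hc (1 - b) b (by linarith) h0 (by linarith), sub_add_cancel]
  have hcomm : ∀ b, 0 ≤ b → b ≤ 1 → Commute (c b) (c 1) := fun b h0 h1 => by
    change c b * c 1 = c 1 * c b
    conv_lhs => rw [← c1' b h0 h1, ← mul_assoc, c1 b h0 h1]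
  let C : ℝ → G := fun t => c (Int.fract t) * c 1 ^ ⌊t⌋
  have hC : ∀ (a : ℝ) (m : ℤ), 0 ≤ a → a < 1 → C (a + m) = c a * c 1 ^ m := fun a m h0 h1 => by
    simp only [C, Int.fract_add_intCast, Int.floor_add_intCast, Int.fract_eq_self.2 ⟨h0, h1⟩,
      Int.floor_eq_zero_iff.2 ⟨h0, h1⟩, zero_add]
  have hfl : ∀ t : ℝ, ∃ (a : ℝ) (m : ℤ), 0 ≤ a ∧ a < 1 ∧ t = a + m := fun t =>
    ⟨Int.fract t, ⌊t⌋, Int.fract_nonneg t, Int.fract_lt_one t, (Int.fract_add_floor t).symm⟩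
  refine ⟨C, fun s t => ?_, fun t ht => ?_⟩
  · obtain ⟨a, m, ha0, ha1, rfl⟩ := hfl s
    obtain ⟨b, n, hb0, hb1, rfl⟩ := hfl t
    have hr : C (a + m) * C (b + n) = c a * c b * c 1 ^ (m + n) := by
      rw [hC a m ha0 ha1, hC b n hb0 hb1, mul_assoc, ← mul_assoc (c 1 ^ m),
        ← ((hcomm b hb0 hb1.le).zpow_right m).eq, zpow_add]
      simp only [mul_assoc]
    rw [hr]
    rcases lt_or_ge (a + b) 1 with h | h
    · rw [show a + (m : ℝ) + (b + n) = (a + b) + ((m + n : ℤ) : ℝ) by push_cast; ring,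
        hC _ _ (by linarith) h, hc a b ha0 hb0 h.le]
    -- With a carry, a = (a + b - 1) + (1 - b) gives c(a)c(b) = c(a + b - 1)c(1).
    · rw [show a + (m : ℝ) + (b + n) = (a + b - 1) + ((1 + (m + n) : ℤ) : ℝ) by push_cast; ring,
        hC _ _ (by linarith) (by linarith), zpow_add, zpow_one, ← mul_assoc]
      congr 1
      conv_rhs => rw [show a = (a + b - 1) + (1 - b) by ring,
        hc (a + b - 1) (1 - b) (by linarith) (by linarith) (by linarith), mul_assoc,
        c1' b hb0 hb1.le]
  · rcases ht.2.lt_or_eq with h | rfl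
    · simpa using hC t 0 ht.1 h
    · simp [C, c0]

/-- Left translation by c(t - t₀) carries smoothness at t₀ to smoothness at t. -/
theorem contMDiff_of_hom {E : Type*} [NormedAddCommGroup E] [NormedSpace ℝ E]
    {G : Type*} [TopologicalSpace G] [ChartedSpace E G] [Group G] [LieGroup 𝓘(ℝ, E) ∞ G]
    {c : ℝ → G} (hc : ∀ s t, c (s + t) = c s * c t) {t₀ : ℝ}
    (h : ContMDiffAt 𝓘(ℝ, ℝ) 𝓘(ℝ, E) ∞ c t₀) : ContMDiff 𝓘(ℝ, ℝ) 𝓘(ℝ, E) ∞ c := by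
  intro t
  have h1 : c = (fun g => c (t - t₀) * g) ∘ c ∘ fun s => s + (t₀ - t) := by
    funext s
    simp only [Function.comp_apply, ← hc]
    congr 1
    ring
  rw [h1]
  have h2 : ContMDiffAt 𝓘(ℝ, ℝ) 𝓘(ℝ, ℝ) ∞ (fun s : ℝ => s + (t₀ - t)) t :=
    (contDiff_id.add contDiff_const).contMDiff.contMDiffAt
  have h3 : ContMDiffAt 𝓘(ℝ, ℝ) 𝓘(ℝ, E) ∞ c (t + (t₀ - t)) := by rwa [add_sub_cancel]
  exact contMDiff_mul_left.contMDiffAt.comp t (h3.comp t h2)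

/-! ### The group law in a chart at the unit -/

section LocalGroup

variable {E : Type*} [NormedAddCommGroup E] [NormedSpace ℝ E]
  {G : Type*} [TopologicalSpace G] [ChartedSpace E G] [Group G]

theorem exists_centered_partialDiffeomorph {E : Type*} [NormedAddCommGroup E] [NormedSpace ℝ E]
    {M : Type*} [TopologicalSpace M] [ChartedSpace E M] [IsManifold 𝓘(ℝ, E) ∞ M] (a : M) :
    ∃ κ : PartialDiffeomorph 𝓘(ℝ, E) 𝓘(ℝ, E) M E ∞, a ∈ κ.source ∧ κ a = 0 := by
  let h : E ≃ₜ E := Homeomorph.addRight (-(chartAt E a a))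
  let e := (chartAt E a).transHomeomorph h
  have h1 : ContMDiff 𝓘(ℝ, E) 𝓘(ℝ, E) ∞ h := (contDiff_id.add contDiff_const).contMDiff
  have h2 : ContMDiff 𝓘(ℝ, E) 𝓘(ℝ, E) ∞ h.symm := (contDiff_id.add contDiff_const).contMDiff
  exact ⟨{ toPartialEquiv := e.toPartialEquiv
           open_source := e.open_source
           open_target := e.open_target
           contMDiffOn_toFun := h1.comp_contMDiffOn contMDiffOn_chart
           contMDiffOn_invFun := contMDiffOn_chart_symm.comp h2.contMDiffOn (mapsTo_preimage _ _) },
    mem_chart_source E a, add_neg_cancel _⟩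

variable (κ : PartialDiffeomorph 𝓘(ℝ, E) 𝓘(ℝ, E) G E ∞)

/-- The group law in the chart `κ`. -/
def chartMul (x y : E) : E := κ (κ.symm x * κ.symm y)

/-- The domain of the group law in the chart `κ`. -/
def chartMulDom : Set (E × E) :=
  {q | q.1 ∈ κ.target ∧ q.2 ∈ κ.target ∧ κ.symm q.1 * κ.symm q.2 ∈ κ.source}

/-- The frame of left invariant vector fields in the chart `κ`. -/
def chartFrame (x : E) : E →L[ℝ] E := fderiv ℝ (chartMul κ x) 0

theorem contMDiffOn_symm_mul_symm [LieGroup 𝓘(ℝ, E) ∞ G] :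
    ContMDiffOn 𝓘(ℝ, E × E) 𝓘(ℝ, E) ∞ (fun q : E × E => κ.symm q.1 * κ.symm q.2)
      (κ.target ×ˢ κ.target) :=
  (κ.contMDiffOn_invFun.comp contDiff_fst.contMDiff.contMDiffOn fun _ hq => hq.1).mul
    (κ.contMDiffOn_invFun.comp contDiff_snd.contMDiff.contMDiffOn fun _ hq => hq.2)

theorem chartMulDom_eq : chartMulDom κ = (κ.target ×ˢ κ.target) ∩
    (fun q : E × E => κ.symm q.1 * κ.symm q.2) ⁻¹' κ.source := by
  ext q
  exact and_assoc.symm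

theorem isOpen_chartMulDom [LieGroup 𝓘(ℝ, E) ∞ G] : IsOpen (chartMulDom κ) := by
  rw [chartMulDom_eq]
  exact (contMDiffOn_symm_mul_symm κ).continuousOn.isOpen_inter_preimage
    (κ.open_target.prod κ.open_target) κ.open_source

theorem contDiffOn_chartMul [LieGroup 𝓘(ℝ, E) ∞ G] :
    ContDiffOn ℝ ∞ (fun q : E × E => chartMul κ q.1 q.2) (chartMulDom κ) := by
  rw [← contMDiffOn_iff_contDiffOn]
  refine κ.contMDiffOn_toFun.comp ((contMDiffOn_symm_mul_symm κ).mono ?_) fun q hq => hq.2.2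
  exact fun q hq => ⟨hq.1, hq.2.1⟩

variable {κ}

theorem symm_chartMul {x y : E} (h : (x, y) ∈ chartMulDom κ) :
    κ.symm (chartMul κ x y) = κ.symm x * κ.symm y :=
  κ.left_inv' h.2.2

theorem chartMul_mem_target {x y : E} (h : (x, y) ∈ chartMulDom κ) :
    chartMul κ x y ∈ κ.target :=
  κ.map_source' h.2.2

theorem zero_mem_target_of_chart (h1 : (1 : G) ∈ κ.source) (h0 : κ 1 = 0) :
    (0 : E) ∈ κ.target := h0 ▸ κ.map_source' h1

theorem symm_zero_of_chart (h1 : (1 : G) ∈ κ.source) (h0 : κ 1 = 0) :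
    κ.symm 0 = 1 := by rw [← h0]; exact κ.left_inv' h1

theorem mk_zero_mem_chartMulDom (h1 : (1 : G) ∈ κ.source) (h0 : κ 1 = 0)
    {x : E} (hx : x ∈ κ.target) : (x, 0) ∈ chartMulDom κ :=
  ⟨hx, zero_mem_target_of_chart h1 h0, by
    simp only [symm_zero_of_chart h1 h0, mul_one]; exact κ.map_target' hx⟩

theorem chartMul_zero (h1 : (1 : G) ∈ κ.source) (h0 : κ 1 = 0)
    {x : E} (hx : x ∈ κ.target) : chartMul κ x 0 = x := by
  rw [chartMul, symm_zero_of_chart h1 h0, mul_one]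
  exact κ.right_inv' hx

theorem zero_chartMul (h1 : (1 : G) ∈ κ.source) (h0 : κ 1 = 0)
    {x : E} (hx : x ∈ κ.target) : chartMul κ 0 x = x := by
  rw [chartMul, symm_zero_of_chart h1 h0, one_mul]
  exact κ.right_inv' hx

theorem hasFDerivAt_chartMul [LieGroup 𝓘(ℝ, E) ∞ G] {x y : E} (h : (x, y) ∈ chartMulDom κ) :
    HasFDerivAt (chartMul κ x) ((fderiv ℝ (fun q : E × E => chartMul κ q.1 q.2) (x, y)) ∘L
      ContinuousLinearMap.inr ℝ E E) y :=
  (((contDiffOn_chartMul κ).contDiffAt ((isOpen_chartMulDom κ).mem_nhds h)).differentiableAt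
    (by simp)).hasFDerivAt.comp y (hasFDerivAt_prodMk_right x y)

theorem contDiffOn_chartFrame [LieGroup 𝓘(ℝ, E) ∞ G] (h1 : (1 : G) ∈ κ.source) (h0 : κ 1 = 0) :
    ContDiffOn ℝ ∞ (chartFrame κ) κ.target := by
  have hd := (contDiffOn_chartMul κ).fderiv_of_isOpen (m := ∞) (isOpen_chartMulDom κ) (by simp)
  have hc : ContDiff ℝ ∞ (fun x : E => (x, (0 : E))) := contDiff_id.prodMk contDiff_const
  refine ((hd.comp hc.contDiffOn
    fun x hx => mk_zero_mem_chartMulDom h1 h0 hx).clm_comp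
      (contDiffOn_const (c := ContinuousLinearMap.inr ℝ E E))).congr fun x hx => ?_
  exact (hasFDerivAt_chartMul (mk_zero_mem_chartMulDom h1 h0 hx)).fderiv

theorem chartFrame_zero (h1 : (1 : G) ∈ κ.source) (h0 : κ 1 = 0) :
    chartFrame κ 0 = ContinuousLinearMap.id ℝ E := by
  have : chartMul κ 0 =ᶠ[𝓝 0] id := by
    filter_upwards [κ.open_target.mem_nhds (zero_mem_target_of_chart h1 h0)] with x hx
    exact zero_chartMul h1 h0 hx
  rw [chartFrame, this.fderiv_eq, fderiv_id]

/-- This is left invariance of the frame: differentiate x(yz) = (xy)z in z at the unit. -/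
theorem fderiv_chartMul_comp_chartFrame [LieGroup 𝓘(ℝ, E) ∞ G]
    (h1 : (1 : G) ∈ κ.source) (h0 : κ 1 = 0) {x y : E}
    (h : (x, y) ∈ chartMulDom κ) :
    (fderiv ℝ (chartMul κ x) y) ∘L (chartFrame κ y) = chartFrame κ (chartMul κ x y) := by
  have hy : y ∈ κ.target := h.2.1
  have hxy := chartMul_mem_target h
  have hz : ∀ {a : E}, a ∈ κ.target → ∀ᶠ z in 𝓝 (0 : E), (a, z) ∈ chartMulDom κ := fun {a} ha =>
    (Continuous.prodMk_right (Y := E) a).continuousAt.eventually_mem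
      ((isOpen_chartMulDom κ).mem_nhds (mk_zero_mem_chartMulDom h1 h0 ha))
  have hd : ∀ {a b : E}, (a, b) ∈ chartMulDom κ →
      HasFDerivAt (chartMul κ a) (fderiv ℝ (chartMul κ a) b) b := fun {a b} hab =>
    (hasFDerivAt_chartMul hab).differentiableAt.hasFDerivAt
  have hl : HasFDerivAt (fun z => chartMul κ x (chartMul κ y z))
      ((fderiv ℝ (chartMul κ x) y) ∘L (chartFrame κ y)) 0 := by
    have hm : HasFDerivAt (chartMul κ x) (fderiv ℝ (chartMul κ x) y) (chartMul κ y 0) := by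
      rw [chartMul_zero h1 h0 hy]
      exact hd h
    exact hm.comp (0 : E) (hd (mk_zero_mem_chartMulDom h1 h0 hy))
  have hr : HasFDerivAt (chartMul κ (chartMul κ x y)) (chartFrame κ (chartMul κ x y)) 0 :=
    hd (mk_zero_mem_chartMulDom h1 h0 hxy)
  refine hl.unique (hr.congr_of_eventuallyEq ?_)
  filter_upwards [hz hy] with z hyz
  rw [chartMul, symm_chartMul hyz, ← mul_assoc, ← symm_chartMul h]
  rfl

end LocalGroup

/-! ### The logarithm of a Lie group -/

section Logarithm

variable {E : Type*} [NormedAddCommGroup E] [NormedSpace ℝ E]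
  {G : Type*} [TopologicalSpace G] [ChartedSpace E G] [Group G] [LieGroup 𝓘(ℝ, E) ∞ G]
  {κ : PartialDiffeomorph 𝓘(ℝ, E) 𝓘(ℝ, E) G E ∞}

/-- Solutions of the left invariant equation `u' = A(u) v` satisfy `u(s + t) = u(s) u(t)`. -/
theorem solution_add_eq_chartMul (h1 : (1 : G) ∈ κ.source) (h0 : κ 1 = 0) {U B : Set E} {L : NNReal}
    (hU : ∀ x ∈ U, ∀ y ∈ U, (x, y) ∈ chartMulDom κ ∧ chartMul κ x y ∈ B) (hUB : U ⊆ B)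
    (hL : LipschitzOnWith L (chartFrame κ) B) {v : E} {u : ℝ → E} (hu0 : u 0 = 0)
    (hu : ∀ t ∈ Icc (0 : ℝ) 1, u t ∈ U ∧ HasDerivWithinAt u (chartFrame κ (u t) v) (Icc 0 1) t)
    {s t : ℝ} (hs : 0 ≤ s) (ht : 0 ≤ t) (hst : s + t ≤ 1) :
    u (s + t) = chartMul κ (u s) (u t) := by
  have hd : ∀ r ∈ Ico (0 : ℝ) 1, HasDerivWithinAt u (chartFrame κ (u r) v) (Ici r) r :=
    fun r hr => (hu r (Ico_subset_Icc_self hr)).2.mono_of_mem_nhdsWithin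
      (Icc_mem_nhdsGE_of_mem hr)
  have huc : ContinuousOn u (Icc 0 1) := fun r hr => (hu r hr).2.continuousWithinAt
  have hsI : s ∈ Icc (0 : ℝ) 1 := ⟨hs, by linarith⟩
  have hadd : MapsTo (fun r => s + r) (Icc 0 (1 - s)) (Icc 0 1) := fun r hr =>
    ⟨by linarith [hr.1], by linarith [hr.2]⟩
  have hsub : Icc 0 (1 - s) ⊆ Icc (0 : ℝ) 1 := Icc_subset_Icc_right (by linarith)
  have hm : ∀ r ∈ Icc (0 : ℝ) 1, HasFDerivAt (chartMul κ (u s)) (fderiv ℝ (chartMul κ (u s)) (u r))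
      (u r) := fun r hr =>
    (hasFDerivAt_chartMul (hU _ (hu s hsI).1 _ (hu r hr).1).1).differentiableAt.hasFDerivAt
  -- By left invariance both curves solve the same equation on [0, 1 - s], starting at u(s). The
  -- product curve may leave U but stays in B, where the frame is Lipschitz.
  refine ODE_solution_unique_of_mem_Icc_right (f := fun r => u (s + r))
    (g := fun r => chartMul κ (u s) (u r)) (v := fun _ x => chartFrame κ x v) (s := fun _ => B)
    (K := ‖ContinuousLinearMap.apply ℝ E v‖₊ * L) (a := 0) (b := 1 - s) (fun _ _ => ?_)
    ?_ (fun r hr => ?_) (fun r hr => ?_) (fun r hr => ?_) (fun r hr => ?_) (fun r hr => ?_) ?_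
    ⟨ht, by linarith⟩
  · exact (ContinuousLinearMap.apply ℝ E v).lipschitz.comp_lipschitzOnWith hL
  · exact huc.comp (by fun_prop) hadd
  · have h2 := (hd (s + r) ⟨by linarith [hr.1], by linarith [hr.2]⟩).scomp r
      ((hasDerivAt_id r).const_add s).hasDerivWithinAt
      (t' := Ici (s + r)) (fun x (hx : r ≤ x) => show s + r ≤ s + x by linarith)
    rwa [one_smul] at h2
  · exact hUB (hu _ (hadd (Ico_subset_Icc_self hr))).1
  · exact (hm r (hsub hr)).continuousAt.comp_continuousWithinAt
      ((huc r (hsub hr)).mono hsub)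
  · have hr' := hsub (Ico_subset_Icc_self hr)
    have h2 := (hm r hr').comp_hasDerivWithinAt r (hd r ⟨hr.1, by linarith [hr.2]⟩)
    rwa [← ContinuousLinearMap.comp_apply, fderiv_chartMul_comp_chartFrame h1 h0
      (hU _ (hu s hsI).1 _ (hu r hr').1).1] at h2
  · exact (hU _ (hu s hsI).1 _ (hu r (hsub (Ico_subset_Icc_self hr))).1).2
  · simp only [add_zero, hu0]
    exact (chartMul_zero h1 h0 (hU _ (hu s hsI).1 _ (hu s hsI).1).1.1).symm

/-- The logarithm of a Lie group is a diffeomorphism from a neighborhood of the unit. -/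
theorem LieGroup.exists_log [FiniteDimensional ℝ E] (G : Type*) [TopologicalSpace G]
    [ChartedSpace E G] [Group G] [LieGroup 𝓘(ℝ, E) ∞ G] :
    ∃ Λ : PartialDiffeomorph 𝓘(ℝ, E) 𝓘(ℝ, E) G E ∞, 1 ∈ Λ.source ∧ Λ 1 = 0 ∧
      ∀ g ∈ Λ.source, ∃ c : ℝ → G, (∀ s t, c (s + t) = c s * c t) ∧
        ContMDiff 𝓘(ℝ, ℝ) 𝓘(ℝ, E) ∞ c ∧ c 1 = g ∧ HasDerivAt (fun t => Λ (c t)) (Λ g) 0 := by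
  obtain ⟨κ, h1, h0⟩ := exists_centered_partialDiffeomorph (E := E) (1 : G)
  have h0t := zero_mem_target_of_chart h1 h0
  have hA := contDiffOn_chartFrame h1 h0
  obtain ⟨L, B, hB, hL⟩ := ((hA.contDiffAt (κ.open_target.mem_nhds h0t)).of_le
    (by simp : (1 : WithTop ℕ∞) ≤ ∞)).exists_lipschitzOnWith
  have hdom := mk_zero_mem_chartMulDom h1 h0 h0t
  have hcont : ContinuousAt (fun q : E × E => chartMul κ q.1 q.2) (0, 0) :=
    ((contDiffOn_chartMul κ).contDiffAt ((isOpen_chartMulDom κ).mem_nhds hdom)).continuousAt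
  have hev : ∀ᶠ q : E × E in 𝓝 0 ×ˢ 𝓝 0, q ∈ chartMulDom κ ∧ chartMul κ q.1 q.2 ∈ B := by
    rw [← nhds_prod_eq]
    refine ((isOpen_chartMulDom κ).eventually_mem hdom).and (hcont.eventually_mem ?_)
    change B ∈ 𝓝 (chartMul κ 0 0)
    rwa [chartMul_zero h1 h0 h0t]
  obtain ⟨U₀, hU₀, hU₀'⟩ := Filter.eventually_prod_self_iff'.1 hev
  obtain ⟨U, hUsub, hU, h0U⟩ := mem_nhds_iff.1
    (Filter.inter_mem (Filter.inter_mem hU₀ hB) (κ.open_target.mem_nhds h0t))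
  have hUU : ∀ x ∈ U, ∀ y ∈ U, (x, y) ∈ chartMulDom κ ∧ chartMul κ x y ∈ B := fun x hx y hy =>
    hU₀' x (hUsub hx).1.1 y (hUsub hy).1.1
  obtain ⟨e, he0s, he0, hes, hes', hed, hsol⟩ := exists_solution_openPartialHomeomorph hU h0U
    (hA.mono fun x hx => (hUsub hx).2) (chartFrame_zero h1 h0)
  let ε : PartialDiffeomorph 𝓘(ℝ, E) 𝓘(ℝ, E) E E ∞ :=
    { toPartialEquiv := e.toPartialEquiv
      open_source := e.open_source
      open_target := e.open_target
      contMDiffOn_toFun := hes.contMDiffOn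
      contMDiffOn_invFun := hes'.contMDiffOn }
  have h0et : (0 : E) ∈ e.target := he0 ▸ e.map_source he0s
  have he0' : e.symm 0 = 0 := by rw [← he0, e.left_inv he0s, he0]
  have hed' : HasFDerivAt e.symm (ContinuousLinearMap.id ℝ E) 0 :=
    e.hasFDerivAt_symm h0et (f' := ContinuousLinearEquiv.refl ℝ E) (by rw [he0']; exact hed)
  -- In the chart, e is the exponential, so its inverse after κ is the logarithm.
  let Λ := κ.trans ε.symm
  have hΛ : ∀ g, Λ g = e.symm (κ g) := fun _ => rfl
  have h1Λ : (1 : G) ∈ Λ.source := ⟨h1, by change κ 1 ∈ e.target; rwa [h0]⟩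
  refine ⟨Λ, h1Λ, by rw [hΛ, h0, he0'], fun g hg => ?_⟩
  obtain ⟨u, hu0, hu1, hu⟩ := hsol (Λ g) (e.map_target hg.2)
  have huT : ∀ t ∈ Icc (0 : ℝ) 1, u t ∈ κ.target := fun t ht => (hUsub (hu t ht).1).2
  obtain ⟨c, hc, hcu⟩ := exists_hom_extend_of_local (c := fun t => κ.symm (u t))
    fun s t hs ht hst => by
      have := solution_add_eq_chartMul h1 h0 hUU (fun x hx => (hUsub hx).1.2) hL hu0 hu hs ht hst
      simp only [this]
      exact symm_chartMul (hUU _ (hu s ⟨hs, by linarith⟩).1 _ (hu t ⟨ht, by linarith⟩).1).1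
  have hu_smooth : ContDiffOn ℝ ∞ u (Icc 0 1) :=
    ODE.contDiffOn_enat_Icc_of_hasDerivWithinAt (n := ⊤) (f := fun _ x => chartFrame κ x (Λ g))
      (u := U) (((hA.mono fun x hx => (hUsub hx).2).comp contDiffOn_snd fun q hq => hq.2).clm_apply
        contDiffOn_const) (fun t ht => (hu t ht).2) (fun t ht => (hu t ht).1)
  have hhalf : Icc (0 : ℝ) 1 ∈ 𝓝 (1 / 2 : ℝ) := Icc_mem_nhds (by norm_num) (by norm_num)
  have hcs : ContMDiff 𝓘(ℝ, ℝ) 𝓘(ℝ, E) ∞ c := by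
    -- The extension is known to agree with the smooth solution only on [0,1], so smoothness is read
    -- off at an interior point.
    refine contMDiff_of_hom hc (t₀ := 1 / 2) ?_
    have h2 : ContMDiffOn 𝓘(ℝ, ℝ) 𝓘(ℝ, E) ∞ (fun t => κ.symm (u t)) (Icc 0 1) :=
      κ.contMDiffOn_invFun.comp hu_smooth.contMDiffOn huT
    exact (h2.congr hcu).contMDiffAt hhalf
  have hc1 : c 1 = g := by
    rw [hcu 1 (by simp), hu1, hΛ, e.right_inv (x := κ g) hg.2]
    exact κ.left_inv' hg.1
  have hc0 : c 0 = 1 := by simpa using hc 0 0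
  refine ⟨c, hc, hcs, hc1, ?_⟩
  -- The ODE gives only the one-sided derivative at 0; differentiability, known from smoothness of
  -- c, makes it the derivative.
  have hdiff : DifferentiableAt ℝ (fun t => Λ (c t)) 0 := by
    refine MDifferentiableAt.differentiableAt ?_
    refine MDifferentiableAt.comp (0 : ℝ) (?_ : MDifferentiableAt 𝓘(ℝ, E) 𝓘(ℝ, E) Λ (c 0))
      (hcs.mdifferentiable (by simp) 0)
    exact Λ.mdifferentiableAt (by simp) (hc0 ▸ h1Λ)
  have hIcc : (0 : ℝ) ∈ Icc (0 : ℝ) 1 := by simp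
  have hright : HasDerivWithinAt (fun t => Λ (c t)) (Λ g) (Icc 0 1) 0 := by
    have h2 : HasDerivWithinAt u (Λ g) (Icc 0 1) 0 := by
      have := (hu 0 hIcc).2
      rwa [hu0, chartFrame_zero h1 h0] at this
    have h3 : HasDerivWithinAt (fun t => e.symm (u t)) (Λ g) (Icc 0 1) 0 :=
      HasFDerivAt.comp_hasDerivWithinAt (l := e.symm) (l' := ContinuousLinearMap.id ℝ E) (0 : ℝ)
        (by rw [hu0]; exact hed') h2
    refine h3.congr_of_mem (fun t ht => ?_) hIcc
    rw [hΛ, hcu t ht]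
    congr 1
    exact κ.right_inv' (huT t ht)
  have huniq : UniqueDiffWithinAt ℝ (Icc (0 : ℝ) 1) 0 := uniqueDiffOn_Icc zero_lt_one 0 hIcc
  rw [← huniq.eq_deriv _ hdiff.hasDerivAt.hasDerivWithinAt hright]
  exact hdiff.hasDerivAt

end Logarithm

/-! ### Constructions of partial diffeomorphisms -/

/-- The product of two partial diffeomorphisms with values in vector spaces. -/
def PartialDiffeomorph.prodSpace {E F : Type*} [NormedAddCommGroup E] [NormedSpace ℝ E]
    [NormedAddCommGroup F] [NormedSpace ℝ F]
    {M N : Type*} [TopologicalSpace M] [ChartedSpace E M] [TopologicalSpace N] [ChartedSpace F N]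
    (f : PartialDiffeomorph 𝓘(ℝ, E) 𝓘(ℝ, E) M E ∞) (g : PartialDiffeomorph 𝓘(ℝ, F) 𝓘(ℝ, F) N F ∞) :
    PartialDiffeomorph (𝓘(ℝ, E).prod 𝓘(ℝ, F)) 𝓘(ℝ, E × F) (M × N) (E × F) ∞ where
  toPartialEquiv := f.toPartialEquiv.prod g.toPartialEquiv
  open_source := f.open_source.prod g.open_source
  open_target := f.open_target.prod g.open_target
  contMDiffOn_toFun := (f.contMDiffOn_toFun.comp contMDiff_fst.contMDiffOn fun _ h => h.1).prodMk_space
    (g.contMDiffOn_toFun.comp contMDiff_snd.contMDiffOn fun _ h => h.2)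
  contMDiffOn_invFun :=
    (f.contMDiffOn_invFun.comp contDiff_fst.contMDiff.contMDiffOn fun _ h => h.1).prodMk
      (g.contMDiffOn_invFun.comp contDiff_snd.contMDiff.contMDiffOn fun _ h => h.2)

/-- A continuous linear equivalence as a partial diffeomorphism. -/
def ContinuousLinearEquiv.toPartialDiffeomorph {E F : Type*} [NormedAddCommGroup E]
    [NormedSpace ℝ E] [NormedAddCommGroup F] [NormedSpace ℝ F] (L : E ≃L[ℝ] F) :
    PartialDiffeomorph 𝓘(ℝ, E) 𝓘(ℝ, F) E F ∞ :=
  L.toDiffeomorph.toPartialDiffeomorph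

/-- Right translation of a Lie group as a partial diffeomorphism. -/
def LieGroup.mulRightPartialDiffeomorph {E : Type*} [NormedAddCommGroup E] [NormedSpace ℝ E]
    {G : Type*} [TopologicalSpace G] [ChartedSpace E G] [Group G] [LieGroup 𝓘(ℝ, E) ∞ G] (h : G) :
    PartialDiffeomorph 𝓘(ℝ, E) 𝓘(ℝ, E) G G ∞ where
  toPartialEquiv := (Equiv.mulRight h).toPartialEquiv
  open_source := isOpen_univ
  open_target := isOpen_univ
  contMDiffOn_toFun := (contMDiff_mul_right (a := h)).contMDiffOn
  contMDiffOn_invFun := (contMDiff_mul_right (a := h⁻¹)).contMDiffOn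

/-- Affine coordinates, normalized to have differential the identity at a given point. -/
theorem IsLocalDiffeomorph.exists_normalized {E V : Type*} [NormedAddCommGroup E] [NormedSpace ℝ E]
    [NormedAddCommGroup V] [NormedSpace ℝ V] {X : Type*} [TopologicalSpace X] [ChartedSpace E X]
    {φ : X → V} (hφ : IsLocalDiffeomorph 𝓘(ℝ, E) 𝓘(ℝ, V) ∞ φ) (x : X) :
    ∃ (A : E ≃L[ℝ] V) (θ : PartialDiffeomorph 𝓘(ℝ, E) 𝓘(ℝ, E) X E ∞), x ∈ θ.source ∧
      (∀ y, affineDifference φ x y = ⟨x, A.symm (φ y - φ x)⟩) ∧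
      (∀ y ∈ θ.source, θ y = A.symm (φ y - φ x)) ∧
      HasMFDerivAt 𝓘(ℝ, E) 𝓘(ℝ, E) θ x (ContinuousLinearMap.id ℝ E) := by
  have hne : (∞ : WithTop ℕ∞) ≠ 0 := by simp
  obtain ⟨Φ, hx, hΦ⟩ := hφ x
  let A : E ≃L[ℝ] V := (hφ x).mfderivToContinuousLinearEquiv hne
  have hA : HasMFDerivAt 𝓘(ℝ, E) 𝓘(ℝ, V) φ x (A : E →L[ℝ] V) :=
    ((hφ x).mdifferentiableAt hne).hasMFDerivAt
  let h : V ≃ₜ E := (Homeomorph.addRight (-(φ x))).trans A.symm.toHomeomorph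
  have h1 : ContDiff ℝ ∞ h := A.symm.contDiff.comp (contDiff_id.add contDiff_const)
  have h2 : ContDiff ℝ ∞ h.symm := A.contDiff.add contDiff_const
  let τ : PartialDiffeomorph 𝓘(ℝ, V) 𝓘(ℝ, E) V E ∞ :=
    { toPartialEquiv := h.toPartialEquiv
      open_source := isOpen_univ
      open_target := isOpen_univ
      contMDiffOn_toFun := h1.contMDiff.contMDiffOn
      contMDiffOn_invFun := h2.contMDiff.contMDiffOn }
  have hθ : EqOn (Φ.trans τ) (fun y => A.symm (φ y - φ x)) Φ.source := fun y hy => by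
    change A.symm (Φ y + -(φ x)) = A.symm (φ y - φ x)
    rw [hΦ hy, sub_eq_add_neg]
  refine ⟨A, Φ.trans τ, ⟨hx, mem_univ _⟩, fun y => ?_, fun y hy => hθ hy.1, ?_⟩
  · have : ContinuousLinearMap.inverse (mfderiv 𝓘(ℝ, E) 𝓘(ℝ, V) φ x) = (A.symm : V →L[ℝ] E) :=
      (congrArg ContinuousLinearMap.inverse hA.mfderiv).trans (ContinuousLinearMap.inverse_equiv A)
    exact congrArg (fun f : V →L[ℝ] E =>
      (⟨x, f (φ y - φ x)⟩ : TangentBundle 𝓘(ℝ, E) X)) this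
  · have h3 : HasMFDerivAt 𝓘(ℝ, V) 𝓘(ℝ, E) (fun v : V => A.symm (v - φ x)) (φ x)
        (A.symm : V →L[ℝ] E) :=
      (A.symm.hasFDerivAt.comp (φ x) ((hasFDerivAt_id (φ x)).sub_const _)).hasMFDerivAt
    refine ((h3.comp x hA).congr_of_eventuallyEq
      (Filter.eventuallyEq_of_mem (Φ.open_source.mem_nhds hx) hθ)).congr_mfderiv ?_
    exact A.coe_symm_comp_coe

/-! ### Difference operators on principal bundles -/

namespace SmoothPrincipalBundle

section

variable {EG EP EX V : Type*}
  [NormedAddCommGroup EG] [NormedSpace ℝ EG] [FiniteDimensional ℝ EG]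
  [NormedAddCommGroup EP] [NormedSpace ℝ EP]
  [NormedAddCommGroup EX] [NormedSpace ℝ EX]
  [NormedAddCommGroup V] [NormedSpace ℝ V]
  {G P X : Type*}
  [TopologicalSpace G] [ChartedSpace EG G] [Group G] [LieGroup 𝓘(ℝ, EG) ∞ G]
  [TopologicalSpace P] [ChartedSpace EP P]
  [TopologicalSpace X] [ChartedSpace EX X]
  [MulAction G P]
  (B : SmoothPrincipalBundle EG EP EX G P X)

/-- In a trivialization, affine coordinates on the base and the logarithm on the group form a chart
F at p; composing it with the inverse of its differential at p preserves both properties and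
normalizes the differential. -/
theorem exists_difference {φ : X → V} (hφ : IsLocalDiffeomorph 𝓘(ℝ, EX) 𝓘(ℝ, V) ∞ φ) (p : P) :
    ∃ D : PartialDiffeomorph 𝓘(ℝ, EP) 𝓘(ℝ, EP) P EP ∞, p ∈ D.source ∧ D p = 0 ∧
      HasMFDerivAt 𝓘(ℝ, EP) 𝓘(ℝ, EP) D p (ContinuousLinearMap.id ℝ EP) ∧
      (∀ q ∈ D.source, tangentMap 𝓘(ℝ, EP) 𝓘(ℝ, EX) B.proj ⟨p, D q⟩ =
        affineDifference φ (B.proj p) (B.proj q)) ∧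
      ∀ q ∈ D.source, B.proj q = B.proj p → ∃ c : ℝ → G, (∀ s t, c (s + t) = c s * c t) ∧
        ContMDiff 𝓘(ℝ, ℝ) 𝓘(ℝ, EG) ∞ c ∧ c 1 • p = q ∧
        tangentMap 𝓘(ℝ, ℝ) 𝓘(ℝ, EP) (fun t => c t • p) ⟨0, (1 : ℝ)⟩ = ⟨p, D q⟩ := by
  have hne : (∞ : WithTop ℕ∞) ≠ 0 := by simp
  obtain ⟨U, Φ, -, hxU, hs, ht, hΦ1, hΦ2⟩ := B.exists_localTriv (B.proj p)
  have hp : p ∈ Φ.source := by rw [hs]; exact hxU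
  obtain ⟨A, θ, hxθ, hθΔ, hθ, hθ'⟩ := hφ.exists_normalized (B.proj p)
  obtain ⟨Λ, h1Λ, hΛ1, hΛ⟩ := LieGroup.exists_log (E := EG) G
  have hθ0 : θ (B.proj p) = 0 := by rw [hθ _ hxθ, sub_self, map_zero]
  -- Right translation by the inverse of the group coordinate of p makes the second entry the
  -- logarithm of the g with g p = q, when q lies in the fiber of p.
  let F : PartialDiffeomorph 𝓘(ℝ, EP) 𝓘(ℝ, EX × EG) P (EX × EG) ∞ :=
    Φ.trans (θ.prodSpace ((LieGroup.mulRightPartialDiffeomorph (Φ p).2⁻¹).trans Λ))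
  have hF : ∀ q, F q = (θ (Φ q).1, Λ ((Φ q).2 * (Φ p).2⁻¹)) := fun _ => rfl
  have hFs : ∀ q, q ∈ F.source ↔ q ∈ Φ.source ∧ (Φ q).1 ∈ θ.source ∧
      (Φ q).2 * (Φ p).2⁻¹ ∈ Λ.source := fun q => by
    change (_ ∧ _ ∧ True ∧ _) ↔ _
    rw [true_and]
    rfl
  have hFp : F p = 0 := by rw [hF, hΦ1 p hp, mul_inv_cancel, hΛ1, hθ0]; rfl
  have hpF : p ∈ F.source := by
    rw [hFs, hΦ1 p hp, mul_inv_cancel]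
    exact ⟨hp, hxθ, h1Λ⟩
  let L : EP ≃L[ℝ] EX × EG :=
    (F.isLocalDiffeomorphAt 𝓘(ℝ, EP) 𝓘(ℝ, EX × EG) ∞ hpF).mfderivToContinuousLinearEquiv hne
  have hL : HasMFDerivAt 𝓘(ℝ, EP) 𝓘(ℝ, EX × EG) F p (L : EP →L[ℝ] EX × EG) :=
    (F.mdifferentiableAt hne hpF).hasMFDerivAt
  let D : PartialDiffeomorph 𝓘(ℝ, EP) 𝓘(ℝ, EP) P EP ∞ := F.trans L.symm.toPartialDiffeomorph
  have hD : ∀ q, D q = L.symm (F q) := fun _ => rfl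
  have hDs : ∀ q ∈ D.source, q ∈ F.source := fun q hq => hq.1
  refine ⟨D, ⟨hpF, mem_univ _⟩, by rw [hD, hFp, map_zero], ?_, fun q hq => ?_, fun q hq hqp => ?_⟩
  · exact ((L.symm.hasFDerivAt.hasMFDerivAt).comp p hL).congr_mfderiv L.coe_symm_comp_coe
  · obtain ⟨hqΦ, hqθ, -⟩ := (hFs q).1 (hDs q hq)
    have hproj : HasMFDerivAt 𝓘(ℝ, EP) 𝓘(ℝ, EX) B.proj p
        (ContinuousLinearMap.fst ℝ EX EG ∘L (L : EP →L[ℝ] EX × EG)) := by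
      have h1 := (B.contMDiff_proj.mdifferentiable hne p).hasMFDerivAt
      have h2 : HasMFDerivAt 𝓘(ℝ, EP) 𝓘(ℝ, EX) (fun q => (F q).1) p
          (ContinuousLinearMap.fst ℝ EX EG ∘L (L : EP →L[ℝ] EX × EG)) :=
        ((ContinuousLinearMap.fst ℝ EX EG).hasFDerivAt.hasMFDerivAt).comp p hL
      -- Since dθ = id at the base point, differentiating this identity shows that dπ is the first
      -- component of L.
      have h3 : θ ∘ B.proj =ᶠ[𝓝 p] fun q => (F q).1 := by
        filter_upwards [Φ.open_source.mem_nhds hp] with r hr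
        rw [hF, hΦ1 r hr]
        rfl
      have h4 := hasMFDerivAt_unique ((hθ'.comp p h1).congr_of_eventuallyEq h3.symm) h2
      exact h1.congr_mfderiv ((ContinuousLinearMap.id_comp _).symm.trans h4)
    have h5 : mfderiv 𝓘(ℝ, EP) 𝓘(ℝ, EX) B.proj p (D q) = A.symm (φ (B.proj q) - φ (B.proj p)) := by
      rw [hproj.mfderiv]
      change (L (L.symm (F q))).1 = _
      rw [L.apply_symm_apply, hF, hΦ1 q hqΦ, hθ _ (hΦ1 q hqΦ ▸ hqθ)]
    rw [hθΔ, tangentMap]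
    exact congrArg _ h5
  · obtain ⟨hqΦ, hqθ, hqΛ⟩ := (hFs q).1 (hDs q hq)
    obtain ⟨c, hc, hcs, hc1, hc'⟩ := hΛ _ hqΛ
    have hc0 : c 0 = 1 := by simpa using hc 0 0
    have hmem : ∀ g : G, g • p ∈ Φ.source := fun g => by
      rw [hs, mem_preimage, B.proj_smul]
      exact hxU
    have hΦg : ∀ g : G, Φ (g • p) = (B.proj p, g * (Φ p).2) := fun g =>
      Prod.ext ((hΦ1 _ (hmem g)).trans (B.proj_smul g p)) (hΦ2 p hp g)
    refine ⟨c, hc, hcs, ?_, ?_⟩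
    · refine Φ.toPartialEquiv.injOn (hmem _) hqΦ ((hΦg _).trans ?_)
      rw [hc1, inv_mul_cancel_right, ← hqp, ← hΦ1 q hqΦ]
    · have hβ0 : c 0 • p = p := by rw [hc0, one_smul]
      have hβ : ContMDiff 𝓘(ℝ, ℝ) 𝓘(ℝ, EP) ∞ (fun t => c t • p) :=
        B.contMDiff_smul.comp (hcs.prodMk contMDiff_const)
      let β' : ℝ →L[ℝ] EP := mfderiv 𝓘(ℝ, ℝ) 𝓘(ℝ, EP) (fun t => c t • p) 0
      have hβ' : HasMFDerivAt 𝓘(ℝ, ℝ) 𝓘(ℝ, EP) (fun t => c t • p) 0 β' :=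
        (hβ.mdifferentiable hne 0).hasMFDerivAt
      have hFβ : (fun t => F (c t • p)) = fun t => ((0 : EX), Λ (c t)) := by
        funext t
        rw [hF, hΦg, mul_inv_cancel_right, hθ0]
      have hL' : HasMFDerivAt 𝓘(ℝ, EP) 𝓘(ℝ, EX × EG) F (c 0 • p) (L : EP →L[ℝ] EX × EG) := by
        rw [hβ0]
        exact hL
      have hFq : F q = (0, Λ ((Φ q).2 * (Φ p).2⁻¹)) := by rw [hF, hΦ1 q hqΦ, hqp, hθ0]
      have h1 : HasFDerivAt (fun t => F (c t • p)) ((L : EP →L[ℝ] EX × EG) ∘L β') (0 : ℝ) :=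
        (HasMFDerivAt.comp (0 : ℝ) hL' hβ').hasFDerivAt
      have h2 : HasDerivAt (fun t => F (c t • p)) (F q) 0 := by
        rw [hFβ, hFq]
        exact (hasDerivAt_const 0 0).prodMk hc'
      have h3 : L (β' 1) = F q :=
        h1.hasDerivAt.unique h2
      have h4 : β' 1 = D q :=
        (L.symm_apply_apply _).symm.trans (congrArg L.symm h3)
      -- The velocity sits over `c 0 • p`, which equals p only propositionally, so the base point is
      -- transported.
      have h5 : ∀ (r : P) (v : EP), r = p →
          (⟨r, v⟩ : TangentBundle 𝓘(ℝ, EP) P) = ⟨p, v⟩ := by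
        rintro r v rfl
        rfl
      exact (congrArg _ h4).trans (h5 _ _ hβ0)

end

end SmoothPrincipalBundle

/-! ### Evaluation at a point and one-parameter subgroups of the gauge group -/

namespace SmoothPrincipalBundle

section

variable {EG EP EX : Type*}
  [NormedAddCommGroup EG] [NormedSpace ℝ EG]
  [NormedAddCommGroup EP] [NormedSpace ℝ EP]
  [NormedAddCommGroup EX] [NormedSpace ℝ EX]
  {G P X : Type*}
  [TopologicalSpace G] [ChartedSpace EG G] [Group G]
  [TopologicalSpace P] [ChartedSpace EP P]
  [TopologicalSpace X] [ChartedSpace EX X]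
  [MulAction G P]
  (B : SmoothPrincipalBundle EG EP EX G P X)

/-- Evaluation `End P_x ≃ P` at the auxiliary point as a partial diffeomorphism. -/
def evalPartialDiffeomorph [IsManifold 𝓘(ℝ, EP) ∞ P] (x : X) :
    PartialDiffeomorph 𝓘(ℝ, EP) 𝓘(ℝ, EP) (B.EndFiber x) P ∞ where
  toPartialEquiv := (B.evalHomeomorph x).toPartialEquiv
  open_source := isOpen_univ
  open_target := isOpen_univ
  contMDiffOn_toFun := (B.contMDiff_evalHomeomorph x).contMDiffOn
  contMDiffOn_invFun := (B.contMDiff_evalHomeomorph_symm x).contMDiffOn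

/-- The isomorphism `EP ≃ At P_x` given by the auxiliary point. -/
def atContinuousLinearEquiv [FiniteDimensional ℝ EP] (x : X) : EP ≃L[ℝ] B.AtFiber x :=
  LinearEquiv.toContinuousLinearEquiv (show EP ≃ₗ[ℝ] B.AtFiber x from B.atLinearEquiv x)

theorem gaugeDiff_apply_self {x : X} (p : B.Fiber x) (q : P) : (B.gaugeDiff p q).toFun p = q :=
  (B.evalEquiv p).right_inv q

theorem Gau.ext_apply {x : X} {ψ χ : B.Gau x} (p : B.Fiber x)
    (h : ψ.1.toFun p = χ.1.toFun p) : ψ = χ :=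
  Subtype.ext ((B.evalEquiv p).injective h)

/-- The element of `Gau P_x` mapping `p` to `g p`. -/
def gauOf {x : X} (p : B.Fiber x) (g : G) : B.Gau x :=
  ⟨B.gaugeDiff p (g • p.1), by
    rw [← B.proj_toFun _ p, gaugeDiff_apply_self, B.proj_smul, p.2]⟩

theorem gauOf_apply {x : X} (p : B.Fiber x) (g : G) : (B.gauOf p g).1.toFun p = g • p.1 :=
  B.gaugeDiff_apply_self p _

/-- By equivariance the map of h sends g p to g h p, so the groupoid order of multiplication gives a
homomorphism rather than an antihomomorphism. -/
theorem gauOf_mul {x : X} (p : B.Fiber x) (g h : G) :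
    B.gauOf p (g * h) = B.gauOf p g * B.gauOf p h := by
  apply Gau.ext_apply B p
  have h1 : (B.gauOf p g).toSelf p = B.act g p := Subtype.ext (B.gauOf_apply p g)
  change _ = (B.gauOf p h).1.toFun ((B.gauOf p g).toSelf p)
  rw [h1, EndFiber.map_act, gauOf_apply, gauOf_apply, mul_smul]

/-- Evaluation at the auxiliary point turns the curve `gauOf (c t)` into the orbit curve c(t)p, so
smoothness and initial velocity can be read in P. -/
theorem isExp_of_hom [IsManifold 𝓘(ℝ, EP) ∞ P] {x : X} {c : ℝ → G}
    (hc : ∀ s t, c (s + t) = c s * c t) (hcs : ContMDiff 𝓘(ℝ, ℝ) 𝓘(ℝ, EG) ∞ c)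
    {v : EP} (hv : tangentMap 𝓘(ℝ, ℝ) 𝓘(ℝ, EP) (fun t => c t • (B.pt x).1) ⟨0, (1 : ℝ)⟩ =
      ⟨(B.pt x).1, v⟩) {ψ : B.EndFiber x} (hψ : c 1 • (B.pt x).1 = ψ.toFun (B.pt x)) :
    B.IsExp (B.atMk (B.pt x) v) ψ := by
  have hβ : ContMDiff 𝓘(ℝ, ℝ) 𝓘(ℝ, EP) ∞ (fun t => c t • (B.pt x).1) :=
    B.contMDiff_smul.comp (hcs.prodMk contMDiff_const)
  have hγ : ContMDiff 𝓘(ℝ, ℝ) 𝓘(ℝ, EP) ∞ (fun t => (B.gauOf (B.pt x) (c t)).1) :=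
    (B.contMDiff_evalHomeomorph_symm x).comp hβ
  refine ⟨fun t => B.gauOf (B.pt x) (c t), fun s t =>
    (congrArg _ (hc s t)).trans (B.gauOf_mul _ _ _), hγ, ?_, ?_⟩
  · have hev := tangentMap_comp_at (I := 𝓘(ℝ, ℝ)) (I' := 𝓘(ℝ, EP)) (I'' := 𝓘(ℝ, EP))
      (f := fun t => (B.gauOf (B.pt x) (c t)).1)
      (g := fun χ : B.EndFiber x => χ.toFun (B.pt x)) (⟨0, (1 : ℝ)⟩ : TangentBundle 𝓘(ℝ, ℝ) ℝ)
      ((B.contMDiff_eval _).mdifferentiable (by simp) _) (hγ.mdifferentiable (by simp) _)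
    have hcomp : (fun χ : B.EndFiber x => χ.toFun (B.pt x)) ∘
        (fun t => (B.gauOf (B.pt x) (c t)).1) = fun t => c t • (B.pt x).1 :=
      funext fun t => B.gauOf_apply _ _
    rw [hcomp, hv] at hev
    exact congrArg B.toAt hev.symm
  · exact (B.evalEquiv (B.pt x)).injective ((B.gauOf_apply _ _).trans hψ)

end

end SmoothPrincipalBundle

end

/-! ### The difference operator on `End P_x` -/

theorem mainTheorem3
    {EG EP EX V : Type*}
    [NormedAddCommGroup EG] [NormedSpace ℝ EG] [FiniteDimensional ℝ EG]
    [NormedAddCommGroup EP] [NormedSpace ℝ EP] [FiniteDimensional ℝ EP]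
    [NormedAddCommGroup EX] [NormedSpace ℝ EX] [FiniteDimensional ℝ EX]
    [NormedAddCommGroup V] [NormedSpace ℝ V]
    {G P X : Type*}
    [TopologicalSpace G] [ChartedSpace EG G] [Group G] [LieGroup 𝓘(ℝ, EG) ∞ G]
    [TopologicalSpace P] [ChartedSpace EP P] [IsManifold 𝓘(ℝ, EP) ∞ P]
    [TopologicalSpace X] [ChartedSpace EX X] [IsManifold 𝓘(ℝ, EX) ∞ X]
    [MulAction G P]
    (B : SmoothPrincipalBundle EG EP EX G P X)
    (φ : X → V) (hφ : IsLocalDiffeomorph 𝓘(ℝ, EX) 𝓘(ℝ, V) ∞ φ) (hφ_inj : Function.Injective φ)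
    (x : X) :
    ∃ Δ : PartialDiffeomorph 𝓘(ℝ, EP) 𝓘(ℝ, B.AtFiber x) (B.EndFiber x) (B.AtFiber x) ∞,
      B.idEnd x ∈ Δ.source ∧
      -- `Δ` covers the affine forward difference operator of the base
      (∀ ψ ∈ Δ.source, B.dproj (Δ ψ).1 = affineDifference φ x (B.target ψ)) ∧
      -- on `Gau P_x` it is the local inverse, with values in `Ad P_x`, of the exponential
      Δ (B.idEnd x) = 0 ∧
      (∀ ψ ∈ Δ.source, B.target ψ = x → Δ ψ ∈ B.AdFiber x ∧ B.IsExp (Δ ψ) ψ) ∧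
      (∀ a ∈ Δ.target, a ∈ B.AdFiber x →
        B.target (Δ.symm a) = x ∧ B.IsExp a (Δ.symm a)) ∧
      -- its differential at `Id_x` is the target trivialization
      (∀ v : TangentSpace 𝓘(ℝ, EP) (B.idEnd x),
        (mfderiv 𝓘(ℝ, EP) 𝓘(ℝ, B.AtFiber x) Δ (B.idEnd x) v : B.AtFiber x).1 =
            B.targetTriv (B.idEnd x) v) := by
  obtain ⟨D, hpD, hD0, hD', hDΔ, hDexp⟩ := B.exists_difference hφ (B.pt x).1
  let A := B.atContinuousLinearEquiv x
  let Δ : PartialDiffeomorph 𝓘(ℝ, EP) 𝓘(ℝ, B.AtFiber x) (B.EndFiber x) (B.AtFiber x) ∞ :=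
    ((B.evalPartialDiffeomorph x).trans D).trans A.toPartialDiffeomorph
  have hΔ : ∀ ψ, Δ ψ = B.atMk (B.pt x) (D (ψ.toFun (B.pt x))) := fun _ => rfl
  have hΔs : ∀ ψ ∈ Δ.source, ψ.toFun (B.pt x) ∈ D.source := fun ψ hψ => hψ.1.2
  have hdiff : ∀ ψ ∈ Δ.source, B.dproj (Δ ψ).1 = affineDifference φ x (B.target ψ) := fun ψ hψ => by
    have h := hDΔ _ (hΔs ψ hψ)
    rw [(B.pt x).2] at h
    exact h
  have hexp : ∀ ψ ∈ Δ.source, B.target ψ = x → Δ ψ ∈ B.AdFiber x ∧ B.IsExp (Δ ψ) ψ := by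
    intro ψ hψ hx
    refine ⟨?_, ?_⟩
    · change (B.dproj (Δ ψ).1).2 = 0
      rw [hdiff ψ hψ, hx, affineDifference, sub_self]
      exact map_zero _
    · obtain ⟨c, hc, hcs, hc1, hc'⟩ := hDexp _ (hΔs ψ hψ) (hx.trans (B.pt x).2.symm)
      exact B.isExp_of_hom hc hcs hc' hc1
  refine ⟨Δ, ⟨⟨mem_univ _, hpD⟩, mem_univ _⟩, hdiff, ?_, hexp, fun a ha hAd => ?_, fun v => ?_⟩
  · change A (D (B.pt x).1) = 0
    rw [hD0, map_zero]
  · have hψ : Δ.symm a ∈ Δ.source := Δ.map_target' ha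
    have hψa : Δ (Δ.symm a) = a := Δ.right_inv' ha
    -- For a in `Ad P_x` the affine difference vanishes; invertibility of dφ_x and injectivity of φ
    -- force the target to be x.
    have hx : B.target (Δ.symm a) = x := by
      obtain ⟨A', -, -, hA', -⟩ := hφ.exists_normalized x
      have h : (B.dproj (Δ (Δ.symm a)).1).2 = 0 := by rw [hψa]; exact hAd
      rw [hdiff _ hψ, hA'] at h
      exact hφ_inj (sub_eq_zero.1 (A'.symm.map_eq_zero_iff.1 h))
    refine ⟨hx, ?_⟩
    have h := (hexp _ hψ hx).2
    rwa [hψa] at h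
  -- As dD = id at the auxiliary point, the differential of Δ is that of evaluation followed by
  -- passage to the class modulo G.
  · have hev : HasMFDerivAt 𝓘(ℝ, EP) 𝓘(ℝ, EP) (fun χ : B.EndFiber x => χ.toFun (B.pt x))
        (B.idEnd x) _ := ((B.contMDiff_eval (B.pt x)).mdifferentiable (by simp) _).hasMFDerivAt
    have h : HasMFDerivAt 𝓘(ℝ, EP) 𝓘(ℝ, B.AtFiber x) Δ (B.idEnd x) _ :=
      (A.hasFDerivAt.hasMFDerivAt).comp (B.idEnd x)
        (HasMFDerivAt.comp (f := fun χ : B.EndFiber x => χ.toFun (B.pt x)) (B.idEnd x) hD' hev)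
    rw [h.mfderiv]
    rfl
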